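/- Let $\gamma>1$ be the Salem number that is a root of $x^4-x^3-x^2-x+1$. For $m\ge 1$ the number $\gamma^m$ is a Salem number of degree $4$; let $S_m(x)=\sum_{j=0}^4 b_{j,m}x^{4-j}$ be its minimal polynomial over $\mathbb{Z}$, and for $n\ge 0$ put $$T_{2n+8,m}(x)=x^{n+4}\left(\sum_{j=0}^4 b_{j,m}\left(x^{n+j}+\frac1{x^{n+j}}\right)+2\right)\in\mathbb{Z}[x].$$ For a nonconstant polynomial $P\in\mathbb{Z}[x]$ let $C(P)$ be the number of complex zeros of $P$, counted with multiplicity, whose modulus is different from $1$, divided by $\deg P$. Then for every $m\ge1$ the limit (the limit ratio) $$LC(T_{2n+8,m})=\lim_{n\to\infty}C(T_{2n+8,m})$$ exists, and $$\lim_{m\to\infty}LC(T_{2n+8,m})=0.$$ Moreover, for every $\varepsilon>0$ there is an $m\ge1$ with $0<LC(T_{2n+8,m})<\varepsilon$, so nonzero limit ratios can be arbitrarily close to $0$; and the coefficients in this family are unbounded: for every $N$ there is an $m\ge 1$ such that for every $n\ge1$ some coefficient of $T_{2n+8,m}$ exceeds $N$ in modulus. (A Salem number is a real algebraic integer greater than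 $1$ whose minimal polynomial, of degree $d$, has exactly one zero of modulus less than $1$ and exactly $d-2$ zeros of modulus $1$.) -/

import Mathlib

open Polynomial Filter Topology

noncomputable section

/-- `I(P)`: number of complex zeros of modulus `< 1`, counted with multiplicity. -/
def insideCount (P : ℤ[X]) : ℕ :=
  open Classical in (P.aroots ℂ).countP (fun z => ‖z‖ < 1)

/-- `U(P)`: number of complex zeros of modulus `1` (unimodular zeros), with multiplicity. -/
def unimodularCount (P : ℤ[X]) : ℕ :=
  open Classical in (P.aroots ℂ).countP (fun z => ‖z‖ = 1)

/-- `E(P)`: number of complex zeros of modulus `> 1`, counted with multiplicity. -/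
def outsideCount (P : ℤ[X]) : ℕ :=
  open Classical in (P.aroots ℂ).countP (fun z => 1 < ‖z‖)

/-- `C(P)`: the number of nonunimodular zeros of `P` divided by the degree of `P`. -/
def nonunimodularRatio (P : ℤ[X]) : ℝ :=
  ((insideCount P : ℝ) + (outsideCount P : ℝ)) / (P.natDegree : ℝ)

/-- `L` is the limit ratio of the sequence `P`: the limit of `C (P n)` as `n → ∞`. -/
def IsLimitRatio (P : ℕ → ℤ[X]) (L : ℝ) : Prop :=
  Tendsto (fun n => nonunimodularRatio (P n)) atTop (𝓝 L)

/-- A Salem number: a real algebraic integer `> 1` whose minimal polynomial, of degree `d`,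
has `d - 2` unimodular zeros and exactly one zero inside the unit circle. -/
def IsSalemNumber (α : ℝ) : Prop :=
  IsIntegral ℤ α ∧ 1 < α ∧
    unimodularCount (minpoly ℤ α) + 2 = (minpoly ℤ α).natDegree ∧
    insideCount (minpoly ℤ α) = 1

/-- `S_m`, the minimal polynomial of `γ ^ m`. -/
def salemPoly (γ : ℝ) (m : ℕ) : ℤ[X] := minpoly ℤ (γ ^ m)

/-- The coefficients `b_{j,m}` in
`S_m = b_{0,m} x^4 + b_{1,m} x^3 + b_{2,m} x^2 + b_{3,m} x + b_{4,m}`. -/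
def salemCoeff (γ : ℝ) (m j : ℕ) : ℤ := (salemPoly γ m).coeff (4 - j)

/-- The polynomial
`T_{2n+8,m} = x^(n+4) * (∑_{j=0}^4 b_{j,m} (x^(n+j) + 1/x^(n+j)) + 2)`,
with the factor `x^(n+4)` multiplied out. -/
def polyT (γ : ℝ) (n m : ℕ) : ℤ[X] :=
  ∑ j ∈ Finset.range 5, C (salemCoeff γ m j) * (X ^ (2 * n + 4 + j) + X ^ (4 - j))
    + C 2 * X ^ (n + 4)

/-- The multiplied-out form of `polyT` agrees with the Laurent form. -/
theorem aeval_polyT (γ : ℝ) (n m : ℕ) (x : ℂ) (hx : x ≠ 0) :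
    aeval x (polyT γ n m) = x ^ (n + 4) *
      (∑ j ∈ Finset.range 5, (salemCoeff γ m j : ℂ) * (x ^ (n + j) + 1 / x ^ (n + j)) + 2) := by
  have key : ∀ j ∈ Finset.range 5,
      (salemCoeff γ m j : ℂ) * (x ^ (2 * n + 4 + j) + x ^ (4 - j)) =
      x ^ (n + 4) * ((salemCoeff γ m j : ℂ) * (x ^ (n + j) + 1 / x ^ (n + j))) := by
    intro j hj
    have hj' : j ≤ 4 := by
      have := Finset.mem_range.mp hj
      omega
    have h1 : x ^ (2 * n + 4 + j) = x ^ (n + 4) * x ^ (n + j) := by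
      rw [← pow_add]
      congr 1
      omega
    have h2 : x ^ (4 - j) = x ^ (n + 4) * (1 / x ^ (n + j)) := by
      rw [mul_one_div, eq_div_iff (pow_ne_zero _ hx), ← pow_add]
      congr 1
      omega
    rw [h1, h2]
    ring
  have e : aeval x (polyT γ n m) = ∑ j ∈ Finset.range 5,
      (salemCoeff γ m j : ℂ) * (x ^ (2 * n + 4 + j) + x ^ (4 - j)) + 2 * x ^ (n + 4) := by
    simp [polyT, map_ofNat (aeval x : ℤ[X] →ₐ[ℤ] ℂ) 2]
  rw [e, Finset.sum_congr rfl key, ← Finset.mul_sum]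
  ring

end

/-!
Write `S = S_m`. It is reciprocal, so `T_{2n+8,m}(x) = S(x) (x^(2n+4) + 1) + 2 x^(n+4)`, and on the
unit circle `x = e^{iθ}`, with the real function `g(θ) = S(x)/x²` (`quarticCosine`),
`T(x) = 2 x^(n+4) (g(θ) cos ((n+2)θ) + 1)`. The limit ratio is the normalised measure of
`{θ : |g(θ)| < 1}` (`isLimitRatio_quarticTwist`). Two lower bounds prove this.

* Where `|g| > 1`, the function `g cos ((n+2)θ) + 1` changes sign between consecutive points
  `kπ/(n+2)`, which gives unimodular zeros in number asymptotic to at least `2n` times the measure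
  of `{|g| > 1}` (`eventually_sum_le_unimodularCount`).
* Where `|g| < 1`, there are no unimodular zeros, so every zero with argument there is
  nonunimodular. The arguments of the zeros are equidistributed (`tendsto_average_arg_roots`):
  the coefficients of `T` are bounded independently of `n`, so Newton's identities bound the power
  sums of the zeros, Jensen's formula bounds the total logarithmic distance of the zeros from the
  unit circle, and together they bound the character sums in Weyl's criterion.

The set `{|g| = 1}` is finite and the zeros number `2n + 8`, so both bounds are sharp to leading
order.

The quartic `x⁴ - x³ - x² - x + 1` is irreducible with roots `γ`, `1/γ`, `a`, `1/a`, `|a| = 1`. The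
`m`-th powers of these are distinct conjugates, hence are the roots of `S_m` (`aroots_salemPoly`).
Therefore `g(θ) = (2 cos θ - γ^m - γ^(-m)) (2 cos θ - 2 Re a^m)`. The second factor has a zero, so
the limit ratio is positive; the first is at least `γ^m - 2` in modulus, so `|g| < 1` confines `x`
to two arcs around `a^m` and its conjugate, whose lengths shrink as `m → ∞`. The coefficient of `x`
in `T` is `-(γ^m + γ^(-m) + 2 Re a^m)`, which is unbounded.
-/

open MeasureTheory AddCircle

/-! ### Weyl's criterion on the additive circle -/

theorem norm_average_sub_le {T : ℝ} {s : Multiset (AddCircle T)} [Fact (0 < T)]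
    (φ ψ : C(AddCircle T, ℂ)) :
    ‖(s.map φ).sum / s.card - (s.map ψ).sum / s.card‖ ≤ ‖φ - ψ‖ := by
  rw [← sub_div, ← Multiset.sum_map_sub, norm_div, RCLike.norm_natCast]
  refine div_le_of_le_mul₀ (Nat.cast_nonneg _) (norm_nonneg _) ?_
  refine (norm_multiset_sum_le _).trans ?_
  rw [Multiset.map_map]
  refine (Multiset.sum_le_card_nsmul _ ‖φ - ψ‖ ?_).trans ?_
  · intro x hx
    obtain ⟨t, -, rfl⟩ := Multiset.mem_map.1 hx
    exact (φ - ψ).norm_coe_le_norm t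
  · simp [mul_comm]

/-- Weyl's criterion on the additive circle: if the averages of the characters `fourier k`, `k ≥ 1`,
over finite multisets tend to `0`, then the averages of every continuous function tend to its
integral. -/
theorem tendsto_average_of_fourier {T : ℝ} [hT : Fact (0 < T)] {s : ℕ → Multiset (AddCircle T)}
    (hs : ∀ᶠ n in atTop, s n ≠ 0)
    (h : ∀ k : ℕ, 1 ≤ k →
      Tendsto (fun n => ((s n).map (fourier (k : ℤ))).sum / ((s n).card : ℂ)) atTop (𝓝 0))
    (φ : C(AddCircle T, ℂ)) :
    Tendsto (fun n => ((s n).map φ).sum / ((s n).card : ℂ)) atTop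
      (𝓝 (∫ t, φ t ∂haarAddCircle)) := by
  have hint : ∀ φ : C(AddCircle T, ℂ), Integrable φ (haarAddCircle (T := T)) := fun φ =>
    φ.continuous.integrable_of_hasCompactSupport (HasCompactSupport.of_compactSpace _)
  have hspan : ∀ φ ∈ Submodule.span ℂ (Set.range (@fourier T)),
      Tendsto (fun n => ((s n).map φ).sum / ((s n).card : ℂ)) atTop
        (𝓝 (∫ t, φ t ∂haarAddCircle)) := by
    intro φ hφ
    induction hφ using Submodule.span_induction with
    | mem φ hφ =>
      obtain ⟨k, rfl⟩ := hφ
      have hI : k ≠ 0 → ∫ t : AddCircle T, fourier k t ∂haarAddCircle = 0 := fun hk =>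
        integral_eq_zero_of_add_right_eq_neg (μ := haarAddCircle)
          (fourier_add_half_inv_index hk hT.out)
      rcases lt_trichotomy k 0 with hk | rfl | hk
      · -- negative frequencies are complex conjugates of positive ones
        rw [hI hk.ne]
        have h1 := h k.natAbs (by omega)
        have h2 : ((k.natAbs : ℕ) : ℤ) = -k := by omega
        rw [h2] at h1
        have h3 := (Complex.continuous_conj.tendsto _).comp h1
        rw [map_zero] at h3
        refine h3.congr fun n => ?_
        simp only [Function.comp_apply, map_div₀, Complex.conj_natCast, map_multiset_sum,
          Multiset.map_map]
        congr 3
        ext t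
        simp
      · refine Tendsto.congr' ?_ tendsto_const_nhds
        filter_upwards [hs] with n hn
        have : ((s n).card : ℂ) ≠ 0 := by simpa using hn
        have e : ⇑(fourier (0 : ℤ)) = fun _ : AddCircle T => (1 : ℂ) := by
          ext t; exact fourier_zero
        rw [e]
        simp [this]
      · rw [hI hk.ne']
        have := h k.toNat (by omega)
        rwa [Int.toNat_of_nonneg hk.le] at this
    | zero => simp
    | add φ ψ _ _ h1 h2 =>
      have := h1.add h2
      rw [← integral_add (hint φ) (hint ψ)] at this
      refine this.congr fun n => ?_
      rw [← add_div, ← Multiset.sum_map_add]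
      rfl
    | smul c φ _ h1 =>
      have := h1.const_mul c
      rw [← integral_const_mul] at this
      refine this.congr fun n => ?_
      rw [← mul_div_assoc, ← Multiset.sum_map_mul_left]
      rfl
  rw [Metric.tendsto_atTop]
  intro ε hε
  have hφ : φ ∈ closure (Submodule.span ℂ (Set.range (@fourier T)) : Set C(AddCircle T, ℂ)) := by
    rw [← Submodule.topologicalClosure_coe, span_fourier_closure_eq_top]
    trivial
  obtain ⟨ψ, hψ, hd⟩ := Metric.mem_closure_iff.1 hφ (ε / 3) (by positivity)
  rw [dist_eq_norm] at hd
  obtain ⟨N, hN⟩ := Metric.tendsto_atTop.1 (hspan ψ hψ) (ε / 3) (by positivity)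
  refine ⟨N, fun n hn => ?_⟩
  have h1 := hN n hn
  have h2 := norm_average_sub_le (s := s n) φ ψ
  have h3 : ‖(∫ t, ψ t ∂haarAddCircle) - ∫ t, φ t ∂(haarAddCircle (T := T))‖ ≤ ‖φ - ψ‖ := by
    rw [← integral_sub (hint ψ) (hint φ)]
    refine (norm_integral_le_of_norm_le_const (C := ‖φ - ψ‖) ?_).trans (by simp)
    refine .of_forall fun t => ?_
    rw [norm_sub_rev]
    exact (φ - ψ).norm_coe_le_norm t
  calc _ ≤ _ := dist_triangle4 _ _ _ _
    _ < ε / 3 + ε / 3 + ε / 3 := by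
        rw [← dist_eq_norm] at h2 h3
        exact add_lt_add_of_lt_of_le (add_lt_add_of_le_of_lt (h2.trans hd.le) h1) (h3.trans hd.le)
    _ = ε := by ring

theorem tendsto_real_average_of_fourier {T : ℝ} [Fact (0 < T)]
    {s : ℕ → Multiset (AddCircle T)} (hs : ∀ᶠ n in atTop, s n ≠ 0)
    (h : ∀ k : ℕ, 1 ≤ k →
      Tendsto (fun n => ((s n).map (fourier (k : ℤ))).sum / ((s n).card : ℂ)) atTop (𝓝 0))
    {φ : AddCircle T → ℝ} (hφ : Continuous φ) :
    Tendsto (fun n => ((s n).map φ).sum / ((s n).card : ℝ)) atTop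
      (𝓝 (∫ t, φ t ∂haarAddCircle)) := by
  have := tendsto_average_of_fourier hs h ⟨fun t => (φ t : ℂ), by fun_prop⟩
  have := (Complex.continuous_re.tendsto _).comp this
  simp only [ContinuousMap.coe_mk, integral_complex_ofReal, Complex.ofReal_re] at this
  refine this.congr fun n => ?_
  have e : ((s n).map fun t => (φ t : ℂ)).sum = (((s n).map φ).sum : ℝ) := by
    rw [← Complex.ofRealHom_eq_coe, map_multiset_sum, Multiset.map_map]
    rfl
  rw [Function.comp_apply, e]
  norm_cast

/-! ### Equidistribution of the arguments of the zeros -/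

/-- Newton's identities for the elements of a multiset. -/
theorem Multiset.sum_map_pow_eq_esymm {R : Type*} [CommRing R] (s : Multiset R) {k : ℕ}
    (hk : 0 < k) :
    (s.map (· ^ k)).sum = (-1) ^ (k + 1) * k * s.esymm k -
      ∑ a ∈ Finset.HasAntidiagonal.antidiagonal k with a.1 ∈ Set.Ioo 0 k,
        (-1) ^ a.1 * s.esymm a.1 * (s.map (· ^ a.2)).sum := by
  classical
  have hps : ∀ j, MvPolynomial.aeval (fun x : s => x.1) (MvPolynomial.psum s R j) =
      (s.map (· ^ j)).sum := by
    intro j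
    simp only [MvPolynomial.psum, map_sum, map_pow, MvPolynomial.aeval_X]
    conv_rhs => rw [← s.map_univ_coe, Multiset.map_map]
    rfl
  have hes : ∀ j, MvPolynomial.aeval (fun x : s => x.1) (MvPolynomial.esymm s R j) =
      s.esymm j := by
    intro j
    rw [MvPolynomial.aeval_esymm_eq_multiset_esymm, s.map_univ_coe]
  have := congrArg (MvPolynomial.aeval (fun x : s => x.1))
    (MvPolynomial.psum_eq_mul_esymm_sub_sum s R k hk)
  simpa only [map_sub, map_mul, map_sum, map_pow, map_neg, map_one, map_natCast, hps, hes]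
    using this

/-- Bounded elementary symmetric functions force bounded power sums, however many elements there
are. -/
theorem exists_norm_psum_le (M : ℝ) (k : ℕ) :
    ∃ B : ℝ, 0 ≤ B ∧ ∀ j, 1 ≤ j → j ≤ k → ∀ s : Multiset ℂ, (∀ i, ‖s.esymm i‖ ≤ M) →
      ‖(s.map (· ^ j)).sum‖ ≤ B := by
  by_cases hM : 0 ≤ M
  swap
  · exact ⟨0, le_rfl, fun j _ _ s hs => absurd ((norm_nonneg _).trans (hs 0)) hM⟩
  induction k with
  | zero => exact ⟨0, le_rfl, by omega⟩
  | succ k ih =>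
    obtain ⟨B, hB, ih⟩ := ih
    refine ⟨B + ((k + 1 : ℕ) * M + (k + 2 : ℕ) * (M * B)), by positivity, ?_⟩
    intro j hj hjk s hs
    rcases Nat.lt_or_ge k j with hlt | hle
    swap
    · exact (ih j hj hle s hs).trans (le_add_of_nonneg_right (by positivity))
    obtain rfl : j = k + 1 := by omega
    rw [s.sum_map_pow_eq_esymm (by omega)]
    refine (norm_sub_le _ _).trans ?_
    have h1 : ‖(-1 : ℂ) ^ (k + 1 + 1) * (k + 1 : ℕ) * s.esymm (k + 1)‖ ≤ (k + 1 : ℕ) * M := by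
      rw [norm_mul, norm_mul, norm_pow, norm_neg, norm_one, one_pow, one_mul,
        RCLike.norm_natCast]
      gcongr
      exact hs _
    have h2 : ‖∑ a ∈ Finset.HasAntidiagonal.antidiagonal (k + 1) with a.1 ∈ Set.Ioo 0 (k + 1),
        (-1) ^ a.1 * s.esymm a.1 * (s.map (· ^ a.2)).sum‖ ≤ (k + 2 : ℕ) * (M * B) := by
      refine (norm_sum_le_of_le _ (f := fun a : ℕ × ℕ => _) (n := fun _ => M * B) ?_).trans ?_
      · intro a ha
        simp only [Finset.mem_filter, Finset.HasAntidiagonal.mem_antidiagonal, Set.mem_Ioo] at ha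
        rw [norm_mul, norm_mul, norm_pow, norm_neg, norm_one, one_pow, one_mul]
        exact mul_le_mul (hs _) (ih _ (by omega) (by omega) s hs) (norm_nonneg _) hM
      · rw [Finset.sum_const, nsmul_eq_mul]
        gcongr
        exact (Finset.card_filter_le _ _).trans (by simp)
    linarith

theorem two_pi_pos_fact : Fact (0 < 2 * Real.pi) := ⟨Real.two_pi_pos⟩

attribute [local instance] two_pi_pos_fact

/-- Polar decomposition of `z ^ k`, the angular part being a character of the argument of `z`. -/
theorem fourier_arg (z : ℂ) (k : ℕ) :
    fourier (k : ℤ) (Complex.arg z : AddCircle (2 * Real.pi)) * (‖z‖ : ℂ) ^ k = z ^ k := by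
  rw [fourier_coe_apply]
  conv_rhs => rw [← Complex.norm_mul_exp_arg_mul_I z, mul_pow, ← Complex.exp_nat_mul]
  rw [mul_comm]
  congr 2
  have : (Real.pi : ℂ) ≠ 0 := by exact_mod_cast Real.pi_ne_zero
  push_cast
  field_simp

/-- For `x ≥ 1` this is `1 - x ^ (-k) ≤ k log x`, for `x ≤ 1` it is `k log x ≤ x ^ k - 1`. -/
theorem abs_pow_sub_one_le {x R : ℝ} (hx : 0 < x) (hxR : x ≤ R) (hR : 1 ≤ R) (k : ℕ) :
    |x ^ k - 1| ≤ k * R ^ k * |Real.log x| := by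
  have hlog : Real.log (x ^ k) = k * Real.log x := Real.log_pow x k
  have hxk : 0 < x ^ k := pow_pos hx k
  rcases le_total 1 x with h | h
  · have h1 : 0 ≤ Real.log x := Real.log_nonneg h
    rw [abs_of_nonneg (sub_nonneg.2 (one_le_pow₀ h)), abs_of_nonneg h1]
    have h2 := Real.one_sub_inv_le_log_of_pos hxk
    rw [hlog] at h2
    calc x ^ k - 1 = x ^ k * (1 - (x ^ k)⁻¹) := by field_simp
      _ ≤ x ^ k * (k * Real.log x) := by gcongr
      _ ≤ R ^ k * (k * Real.log x) := by gcongr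
      _ = _ := by ring
  · have h1 : Real.log x ≤ 0 := Real.log_nonpos hx.le h
    rw [abs_of_nonpos (sub_nonpos.2 (pow_le_one₀ hx.le h)), abs_of_nonpos h1]
    have h2 := Real.log_le_sub_one_of_pos hxk
    rw [hlog] at h2
    have h3 : 1 ≤ R ^ k := one_le_pow₀ hR
    have h4 : 0 ≤ k * -Real.log x := mul_nonneg (Nat.cast_nonneg k) (by linarith)
    nlinarith

/-- Jensen's formula bounds the total logarithmic distance of the roots from the unit circle. -/
theorem sum_abs_log_norm_roots_le {p : ℂ[X]} (hp : p.Monic) (h0 : ‖p.coeff 0‖ = 1) {L : ℝ}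
    (hL : p.sum (fun _ a => ‖a‖) ≤ L) :
    (p.roots.map fun z => |Real.log ‖z‖|).sum ≤ 2 * Real.log L ∧
      ∀ z ∈ p.roots, ‖z‖ ≤ L := by
  have hM := p.mahlerMeasure_le_sum_norm_coeff.trans hL
  have hM0 := mahlerMeasure_pos_of_ne_zero hp.ne_zero
  have hlog : (p.roots.map fun z => Real.posLog ‖z‖).sum ≤ Real.log L := by
    have := logMahlerMeasure_eq_log_leadingCoeff_add_sum_log_roots p
    rw [hp.leadingCoeff, norm_one, Real.log_one, zero_add,
      logMahlerMeasure_eq_log_MahlerMeasure] at this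
    rw [← this]
    exact Real.log_le_log hM0 hM
  have hz0 : ∀ z ∈ p.roots, z ≠ 0 := by
    rintro z hz rfl
    have := (mem_roots'.1 hz).2
    rw [IsRoot, ← coeff_zero_eq_eval_zero] at this
    simp [this] at h0
  -- the product of the roots has modulus `1`, so the logarithms inside and outside balance
  have hprod : (p.roots.map fun z => Real.log ‖z‖).sum = 0 := by
    have h1 := (IsAlgClosed.splits p).coeff_zero_eq_prod_roots_of_monic hp
    have h2 : (p.roots.map fun z => ‖z‖).prod = 1 := by
      have h3 : ‖p.roots.prod‖ = 1 := by
        rw [← h0, h1, norm_mul, norm_pow, norm_neg, norm_one, one_pow, one_mul]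
      rw [← h3]
      exact (map_multiset_prod (normHom : ℂ →*₀ ℝ) p.roots).symm
    have h4 := Real.log_multiset_prod (s := p.roots.map fun z => ‖z‖) (by
      intro x hx
      obtain ⟨z, hz, rfl⟩ := Multiset.mem_map.1 hx
      exact norm_ne_zero_iff.2 (hz0 z hz))
    rw [h2, Real.log_one, Multiset.map_map] at h4
    exact h4.symm
  have habs : ∀ x : ℝ, |x| = 2 * max 0 x - x := by
    intro x
    rcases le_total 0 x with h | h
    · rw [abs_of_nonneg h, max_eq_right h]; ring
    · rw [abs_of_nonpos h, max_eq_left h]; ring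
  refine ⟨?_, fun z hz => ?_⟩
  · have : (p.roots.map fun z => |Real.log ‖z‖|).sum =
        2 * (p.roots.map fun z => Real.posLog ‖z‖).sum -
          (p.roots.map fun z => Real.log ‖z‖).sum := by
      rw [← Multiset.sum_map_mul_left, ← Multiset.sum_map_sub]
      simp_rw [habs]
      rfl
    rw [this, hprod]
    linarith
  · have h1 : Real.posLog ‖z‖ ≤ (p.roots.map fun z => Real.posLog ‖z‖).sum :=
      Multiset.single_le_sum (by
        intro x hx
        obtain ⟨z, -, rfl⟩ := Multiset.mem_map.1 hx
        exact Real.posLog_nonneg) _ (Multiset.mem_map_of_mem _ hz)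
    have h2 : Real.log ‖z‖ ≤ Real.log L := (le_max_right _ _).trans (h1.trans hlog)
    exact (Real.log_le_log_iff (norm_pos_iff.2 (hz0 z hz)) (hM0.trans_le hM)).1 h2

theorem norm_coeff_le_sum_norm {p : ℂ[X]} (i : ℕ) : ‖p.coeff i‖ ≤ p.sum fun _ a => ‖a‖ := by
  by_cases hi : i ∈ p.support
  · exact Finset.single_le_sum (f := fun i => ‖p.coeff i‖) (fun _ _ => norm_nonneg _) hi
  · rw [notMem_support_iff.1 hi, norm_zero]
    exact Finset.sum_nonneg fun _ _ => norm_nonneg _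

theorem norm_esymm_roots_le {p : ℂ[X]} (hp : p.Monic) {L : ℝ}
    (hL : p.sum (fun _ a => ‖a‖) ≤ L) (i : ℕ) : ‖p.roots.esymm i‖ ≤ L := by
  have hL0 : 0 ≤ L := (Finset.sum_nonneg fun _ _ => norm_nonneg _).trans hL
  have hcard := splits_iff_card_roots.1 (IsAlgClosed.splits p)
  rcases Nat.lt_or_ge p.natDegree i with h | h
  · rw [Multiset.esymm, Multiset.powersetCard_eq_empty _ (by omega)]
    simpa using hL0
  · have := coeff_eq_esymm_roots_of_card hcard (Nat.sub_le p.natDegree i)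
    rw [hp.leadingCoeff, one_mul, Nat.sub_sub_self h] at this
    refine le_trans ?_ ((norm_coeff_le_sum_norm (p.natDegree - i)).trans hL)
    rw [this, norm_mul, norm_pow, norm_neg, norm_one, one_pow, one_mul]

/-- The character sums over the arguments of the roots are bounded in terms of the coefficients
only, independently of the degree. -/
theorem exists_norm_sum_fourier_arg_le (L : ℝ) {k : ℕ} (hk : 1 ≤ k) :
    ∃ B : ℝ, ∀ p : ℂ[X], p.Monic → ‖p.coeff 0‖ = 1 → p.sum (fun _ a => ‖a‖) ≤ L →
      ‖((p.roots.map fun z : ℂ => (Complex.arg z : AddCircle (2 * Real.pi))).map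
        (fourier (k : ℤ))).sum‖ ≤ B := by
  obtain ⟨B, -, hB⟩ := exists_norm_psum_le L k
  refine ⟨k * L ^ k * (2 * Real.log L) + B, fun p hp h0 hL => ?_⟩
  obtain ⟨hsum, hle⟩ := sum_abs_log_norm_roots_le hp h0 hL
  have hL1 : 1 ≤ L := h0 ▸ (norm_coeff_le_sum_norm 0).trans hL
  have hz0 : ∀ z ∈ p.roots, z ≠ 0 := by
    rintro z hz rfl
    have := (mem_roots'.1 hz).2
    rw [IsRoot, ← coeff_zero_eq_eval_zero] at this
    simp [this] at h0
  have hps := hB k hk le_rfl p.roots (norm_esymm_roots_le hp hL)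
  rw [Multiset.map_map]
  set e : ℂ → ℂ := fourier (k : ℤ) ∘ fun z : ℂ => (Complex.arg z : AddCircle (2 * Real.pi)) with he
  have hen : ∀ z, ‖e z‖ = 1 := fun z => by
    rw [he, Function.comp_apply, fourier_apply, Circle.norm_coe]
  have hdiff : ‖(p.roots.map fun z => e z - z ^ k).sum‖ ≤ k * L ^ k * (2 * Real.log L) := by
    refine (norm_multiset_sum_le _).trans ?_
    rw [Multiset.map_map]
    calc _ ≤ (p.roots.map fun z => k * L ^ k * |Real.log ‖z‖|).sum := by
          refine Multiset.sum_map_le_sum_map _ _ fun z hz => ?_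
          have h1 : e z - z ^ k = e z * (1 - (‖z‖ : ℂ) ^ k) := by
            rw [← fourier_arg z k, mul_sub, mul_one]; rfl
          have h2 : (1 - (‖z‖ : ℂ) ^ k) = ((1 - ‖z‖ ^ k : ℝ) : ℂ) := by push_cast; rfl
          rw [Function.comp_apply, h1, norm_mul, hen, one_mul, h2, Complex.norm_real,
            Real.norm_eq_abs, abs_sub_comm]
          exact abs_pow_sub_one_le (norm_pos_iff.2 (hz0 z hz)) (hle z hz) hL1 k
      _ = k * L ^ k * (p.roots.map fun z => |Real.log ‖z‖|).sum := Multiset.sum_map_mul_left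
      _ ≤ _ := by gcongr
  have hsplit : (p.roots.map e).sum =
      (p.roots.map fun z => e z - z ^ k).sum + (p.roots.map (· ^ k)).sum := by
    rw [Multiset.sum_map_sub, sub_add_cancel]
  rw [hsplit]
  exact (norm_add_le _ _).trans (add_le_add hdiff hps)

/-- The arguments of the zeros of monic polynomials of growing degree, with constant coefficient of
modulus one and bounded total coefficient size, are equidistributed. -/
theorem tendsto_average_arg_roots {p : ℕ → ℂ[X]} {L : ℝ} (hp : ∀ n, (p n).Monic)
    (h0 : ∀ n, ‖(p n).coeff 0‖ = 1) (hL : ∀ n, (p n).sum (fun _ a => ‖a‖) ≤ L)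
    (hdeg : Tendsto (fun n => (p n).natDegree) atTop atTop)
    {φ : AddCircle (2 * Real.pi) → ℝ} (hφ : Continuous φ) :
    Tendsto (fun n => ((p n).roots.map fun z => φ (Complex.arg z)).sum / ((p n).natDegree : ℝ))
      atTop (𝓝 (∫ t, φ t ∂haarAddCircle)) := by
  have hcard : ∀ n, (p n).roots.card = (p n).natDegree := fun n =>
    splits_iff_card_roots.1 (IsAlgClosed.splits (p n))
  have := tendsto_real_average_of_fourier
    (s := fun n => (p n).roots.map fun z : ℂ => (Complex.arg z : AddCircle (2 * Real.pi))) ?_ ?_ hφ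
  · simpa only [Multiset.map_map, Multiset.card_map, hcard, Function.comp_def] using this
  · filter_upwards [hdeg.eventually_ge_atTop 1] with n hn h
    have := congrArg Multiset.card h
    rw [Multiset.card_map, hcard, Multiset.card_zero] at this
    omega
  · intro k hk
    obtain ⟨B, hB⟩ := exists_norm_sum_fourier_arg_le L hk
    have hlim : Tendsto (fun n => B / ((p n).natDegree : ℝ)) atTop (𝓝 0) :=
      tendsto_const_nhds.div_atTop (tendsto_natCast_atTop_atTop.comp hdeg)
    refine squeeze_zero_norm (fun n => ?_) hlim
    rw [norm_div, Multiset.card_map, hcard, RCLike.norm_natCast]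
    gcongr
    exact hB _ (hp n) (h0 n) (hL n)

/-! ### Reciprocal quartics and their twists -/

/-- The polynomial `S(x)(x^(2n+4) + 1) + 2 x^(n+4)` built from the reciprocal quartic
`S = x⁴ + A x³ + B x² + A x + 1`. -/
noncomputable def quarticTwist (A B : ℤ) (n : ℕ) : ℤ[X] :=
  (X ^ 4 + C A * X ^ 3 + C B * X ^ 2 + C A * X + 1) *
    (X ^ (2 * n + 4) + 1) + C 2 * X ^ (n + 4)

/-- The real trigonometric polynomial `S(x)/x²`, `x = e^{iθ}`, of the reciprocal quartic
`S = x⁴ + A x³ + B x² + A x + 1`. -/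
noncomputable def quarticCosine (A B : ℝ) (θ : AddCircle (2 * Real.pi)) : ℝ :=
  2 * ((toCircle θ : ℂ) ^ 2).re + 2 * A * (toCircle θ : ℂ).re + B

theorem continuous_quarticCosine (A B : ℝ) : Continuous (quarticCosine A B) := by
  unfold quarticCosine; fun_prop

theorem sq_add_one_of_norm_eq_one {v : ℂ} (hv : ‖v‖ = 1) : v ^ 2 + 1 = 2 * v * (v.re : ℂ) := by
  have h1 : v * (starRingEnd ℂ) v = 1 := by
    rw [Complex.mul_conj, Complex.normSq_eq_norm_sq, hv]; norm_num
  have h2 : v + (starRingEnd ℂ) v = (2 * v.re : ℝ) := Complex.add_conj v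
  push_cast at h2
  linear_combination v * h2 - h1

/-- This identifies `quarticCosine` with `S(x)/x²` on the unit circle. -/
theorem quartic_eq_sq_mul_quarticCosine (A B : ℝ) (θ : AddCircle (2 * Real.pi)) :
    (toCircle θ : ℂ) ^ 4 + A * (toCircle θ : ℂ) ^ 3 + B * (toCircle θ : ℂ) ^ 2 +
      A * (toCircle θ : ℂ) + 1 = (toCircle θ : ℂ) ^ 2 * (quarticCosine A B θ : ℂ) := by
  have hu : ‖(toCircle θ : ℂ)‖ = 1 := Circle.norm_coe _
  have hu2 : ‖(toCircle θ : ℂ) ^ 2‖ = 1 := by rw [norm_pow, hu, one_pow]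
  unfold quarticCosine
  push_cast
  linear_combination (toCircle θ : ℂ) * A * sq_add_one_of_norm_eq_one hu +
    sq_add_one_of_norm_eq_one hu2

theorem aeval_quarticTwist (A B : ℤ) (n : ℕ) (θ : AddCircle (2 * Real.pi)) :
    aeval (toCircle θ : ℂ) (quarticTwist A B n) = (toCircle θ : ℂ) ^ (n + 4) *
      ((2 * (quarticCosine A B θ * ((toCircle θ : ℂ) ^ (n + 2)).re + 1) : ℝ) : ℂ) := by
  have hv : ‖(toCircle θ : ℂ) ^ (n + 2)‖ = 1 := by rw [norm_pow, Circle.norm_coe, one_pow]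
  have h1 := sq_add_one_of_norm_eq_one hv
  have h2 := quartic_eq_sq_mul_quarticCosine A B θ
  simp only [quarticTwist, map_add, map_mul, map_pow, aeval_X, aeval_C, map_one]
  simp only [algebraMap_int_eq, eq_intCast, Complex.ofReal_intCast] at h2 ⊢
  rw [h2]
  push_cast
  linear_combination (toCircle θ : ℂ) ^ 2 * (quarticCosine A B θ : ℂ) * h1

theorem quarticTwist_eq_X_pow_add (A B : ℤ) (n : ℕ) :
    quarticTwist A B n = X ^ (2 * n + 8) + (C A * X ^ (2 * n + 7) +
      C B * X ^ (2 * n + 6) + C A * X ^ (2 * n + 5) +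
      C 1 * X ^ (2 * n + 4) + C 2 * X ^ (n + 4) + C 1 * X ^ 4 +
      C A * X ^ 3 + C B * X ^ 2 + C A * X ^ 1 +
      C 1 * X ^ 0) := by
  unfold quarticTwist
  rw [map_one]
  ring

theorem quarticTwist_tail_degree_lt (A B : ℤ) (n : ℕ) :
    (C A * X ^ (2 * n + 7) +
      C B * X ^ (2 * n + 6) + C A * X ^ (2 * n + 5) +
      C 1 * X ^ (2 * n + 4) + C 2 * X ^ (n + 4) + C 1 * X ^ 4 +
      C A * X ^ 3 + C B * X ^ 2 + C A * X ^ 1 +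
      C 1 * X ^ 0 : ℤ[X]).degree < ((2 * n + 8 : ℕ) : WithBot ℕ) := by
  refine lt_of_le_of_lt (b := ((2 * n + 7 : ℕ) : WithBot ℕ)) ?_ (by norm_cast; omega)
  refine degree_le_of_natDegree_le ?_
  compute_degree
  omega

theorem quarticTwist_monic (A B : ℤ) (n : ℕ) : (quarticTwist A B n).Monic := by
  rw [quarticTwist_eq_X_pow_add]
  exact monic_X_pow_add (quarticTwist_tail_degree_lt A B n)

theorem quarticTwist_natDegree (A B : ℤ) (n : ℕ) : (quarticTwist A B n).natDegree = 2 * n + 8 := by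
  rw [quarticTwist_eq_X_pow_add]
  refine natDegree_eq_of_degree_eq_some ?_
  rw [degree_add_eq_left_of_degree_lt, degree_X_pow]
  rw [degree_X_pow]
  exact quarticTwist_tail_degree_lt A B n

theorem quarticTwist_coeff_zero (A B : ℤ) (n : ℕ) : (quarticTwist A B n).coeff 0 = 1 := by
  simp [quarticTwist, coeff_zero_eq_eval_zero]

theorem quarticTwist_coeff_one (A B : ℤ) (n : ℕ) : (quarticTwist A B n).coeff 1 = A := by
  rw [quarticTwist_eq_X_pow_add]
  simp only [coeff_add, coeff_C_mul, coeff_X_pow]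
  simp

theorem sum_norm_coeff_add_C_mul_X_pow_le {p : ℂ[X]} {L : ℝ} (hp : p.sum (fun _ a => ‖a‖) ≤ L)
    (c : ℂ) (k : ℕ) : (p + C c * X ^ k).sum (fun _ a => ‖a‖) ≤ L + ‖c‖ := by
  set q := C c * (X : ℂ[X]) ^ k with hq
  have h0 : ∀ _ : ℕ, ‖(0 : ℂ)‖ = 0 := fun _ => norm_zero
  have hqs : q.sum (fun _ a => ‖a‖) = ‖c‖ := by
    rw [hq, C_mul_X_pow_eq_monomial, sum_monomial_index _ _ norm_zero]
  set d := max (p + q).natDegree (max p.natDegree q.natDegree) + 1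
  rw [← hqs]
  refine le_trans ?_ (add_le_add_left hp _)
  rw [sum_over_range' (p + q) h0 d (by omega), sum_over_range' p h0 d (by omega),
    sum_over_range' q h0 d (by omega), ← Finset.sum_add_distrib]
  refine Finset.sum_le_sum fun i _ => ?_
  rw [coeff_add]
  exact norm_add_le _ _

theorem exists_sum_norm_coeff_quarticTwist_le (A B : ℤ) : ∃ L : ℝ, ∀ n,
    ((quarticTwist A B n).map (algebraMap ℤ ℂ)).sum (fun _ a => ‖a‖) ≤ L := by
  refine ⟨0 + ‖(1 : ℂ)‖ + ‖(A : ℂ)‖ + ‖(B : ℂ)‖ + ‖(A : ℂ)‖ + ‖(1 : ℂ)‖ + ‖(2 : ℂ)‖ + ‖(1 : ℂ)‖ +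
    ‖(A : ℂ)‖ + ‖(B : ℂ)‖ + ‖(A : ℂ)‖ + ‖(1 : ℂ)‖, fun n => ?_⟩
  have e : (quarticTwist A B n).map (algebraMap ℤ ℂ) = 0 + C 1 * X ^ (2 * n + 8) +
      C (A : ℂ) * X ^ (2 * n + 7) + C (B : ℂ) * X ^ (2 * n + 6) +
      C (A : ℂ) * X ^ (2 * n + 5) + C 1 * X ^ (2 * n + 4) +
      C 2 * X ^ (n + 4) + C 1 * X ^ 4 + C (A : ℂ) * X ^ 3 +
      C (B : ℂ) * X ^ 2 + C (A : ℂ) * X ^ 1 + C 1 * X ^ 0 := by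
    rw [quarticTwist_eq_X_pow_add]
    simp only [Polynomial.map_add, Polynomial.map_mul, Polynomial.map_pow, map_X, map_C]
    simp only [algebraMap_int_eq, eq_intCast, Int.cast_one, Int.cast_ofNat]
    rw [map_one]
    ring
  rw [e]
  iterate 11 refine sum_norm_coeff_add_C_mul_X_pow_le ?_ _ _
  simp [Polynomial.sum]

/-! ### Counting unimodular and nonunimodular zeros -/

theorem counts_add_eq_natDegree {P : ℤ[X]} (hP : P.Monic) :
    insideCount P + unimodularCount P + outsideCount P = P.natDegree := by
  classical
  have hcard : (P.aroots ℂ).card = P.natDegree := by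
    rw [aroots, splits_iff_card_roots.1 (IsAlgClosed.splits _), hP.natDegree_map]
  rw [← hcard]
  unfold insideCount unimodularCount outsideCount
  induction P.aroots ℂ using Multiset.induction_on with
  | empty => simp
  | cons z s ih =>
    simp only [Multiset.countP_cons, Multiset.card_cons]
    rcases lt_trichotomy ‖z‖ 1 with h | h | h
    · rw [if_pos h, if_neg h.ne, if_neg h.not_gt]; omega
    · rw [if_neg h.not_lt, if_pos h, if_neg h.not_gt]; omega
    · rw [if_neg h.not_gt, if_neg h.ne', if_pos h]; omega

/-- A weight at most `1`, and nonpositive on unimodular zeros, counts at most the nonunimodular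
ones. -/
theorem sum_map_le_nonunimodular {P : ℤ[X]} {ψ : ℂ → ℝ} (h1 : ∀ z, ψ z ≤ 1)
    (h0 : ∀ z ∈ P.aroots ℂ, ‖z‖ = 1 → ψ z ≤ 0) :
    ((P.aroots ℂ).map ψ).sum ≤ (insideCount P : ℝ) + outsideCount P := by
  classical
  unfold insideCount outsideCount
  generalize P.aroots ℂ = s at h0 ⊢
  induction s using Multiset.induction_on with
  | empty => simp
  | cons z s ih =>
    have ih := ih fun w hw => h0 w (Multiset.mem_cons_of_mem hw)
    have hz := h0 z (Multiset.mem_cons_self z s)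
    have hz1 := h1 z
    simp only [Multiset.countP_cons, Multiset.map_cons, Multiset.sum_cons]
    rcases lt_trichotomy ‖z‖ 1 with h | h | h
    · rw [if_pos h, if_neg h.not_gt]; push_cast; linarith
    · rw [if_neg h.not_lt, if_neg h.not_gt]; push_cast; linarith [hz h]
    · rw [if_neg h.not_gt, if_pos h]; push_cast; linarith

theorem card_le_unimodularCount {P : ℤ[X]} (hP : P ≠ 0) {s : Finset ℂ}
    (hs : ∀ z ∈ s, ‖z‖ = 1 ∧ aeval z P = 0) : s.card ≤ unimodularCount P := by
  classical
  unfold unimodularCount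
  rw [Multiset.countP_eq_card_filter]
  refine Multiset.card_le_card ((Multiset.le_iff_subset s.nodup).2 fun z hz => ?_)
  rw [Multiset.mem_filter, mem_aroots]
  exact ⟨⟨hP, (hs z hz).2⟩, (hs z hz).1⟩

theorem coe_toCircle_coe (t : ℝ) :
    (toCircle (t : AddCircle (2 * Real.pi)) : ℂ) = Complex.exp (t * Complex.I) := by
  rw [toCircle_apply_mk, Circle.coe_exp, div_self Real.two_pi_pos.ne', one_mul]

theorem toCircle_arg {b : ℂ} (hb : ‖b‖ = 1) :
    (toCircle (Complex.arg b : AddCircle (2 * Real.pi)) : ℂ) = b := by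
  have := Complex.norm_mul_exp_arg_mul_I b
  rw [hb, Complex.ofReal_one, one_mul] at this
  rw [coe_toCircle_coe, this]

theorem re_toCircle_coe_pow (t : ℝ) (N : ℕ) :
    ((toCircle (t : AddCircle (2 * Real.pi)) : ℂ) ^ N).re = Real.cos (N * t) := by
  rw [coe_toCircle_coe, ← Complex.exp_nat_mul, ← mul_assoc]
  exact_mod_cast Complex.exp_ofReal_mul_I_re (N * t)

theorem aeval_quarticTwist_coe_eq_zero_iff (A B : ℤ) (n : ℕ) (t : ℝ) :
    aeval (toCircle (t : AddCircle (2 * Real.pi)) : ℂ) (quarticTwist A B n) = 0 ↔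
      quarticCosine A B (t : AddCircle (2 * Real.pi)) * Real.cos ((n + 2 : ℕ) * t) + 1 = 0 := by
  rw [aeval_quarticTwist, re_toCircle_coe_pow, mul_eq_zero, Complex.ofReal_eq_zero]
  have : (toCircle (t : AddCircle (2 * Real.pi)) : ℂ) ^ (n + 4) ≠ 0 :=
    pow_ne_zero _ (Circle.coe_ne_zero _)
  simp [this]

/-- Test functions supported where `|S(x)/x²| < 1` on the unit circle see only nonunimodular
zeros. -/
theorem sum_map_arg_le_nonunimodular (A B : ℤ) (n : ℕ) {ψ : AddCircle (2 * Real.pi) → ℝ}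
    (h1 : ∀ θ, ψ θ ≤ 1) (h0 : ∀ θ, 0 < ψ θ → |quarticCosine A B θ| < 1) :
    (((quarticTwist A B n).aroots ℂ).map fun z => ψ (Complex.arg z)).sum ≤
      (insideCount (quarticTwist A B n) : ℝ) + outsideCount (quarticTwist A B n) := by
  refine sum_map_le_nonunimodular (fun z => h1 _) fun z hz hz1 => ?_
  by_contra! hlt
  have hg := h0 _ hlt
  have hzt := toCircle_arg hz1
  have hroot := (mem_aroots.1 hz).2
  rw [← hzt, aeval_quarticTwist_coe_eq_zero_iff] at hroot
  have h2 := Real.abs_cos_le_one ((n + 2 : ℕ) * Complex.arg z)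
  have h3 : |quarticCosine A B (Complex.arg z : AddCircle (2 * Real.pi)) *
      Real.cos ((n + 2 : ℕ) * Complex.arg z)| = 1 := by
    rw [eq_neg_of_add_eq_zero_left hroot, abs_neg, abs_one]
  rw [abs_mul] at h3
  nlinarith [abs_nonneg (quarticCosine A B (Complex.arg z : AddCircle (2 * Real.pi))),
    abs_nonneg (Real.cos ((n + 2 : ℕ) * Complex.arg z))]

theorem cos_nat_mul_pi_div {N : ℕ} (hN : N ≠ 0) (k : ℕ) :
    Real.cos (N * (k * Real.pi / N)) = (-1) ^ k := by
  have : (N : ℝ) * (k * Real.pi / N) = k * Real.pi := by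
    have : (N : ℝ) ≠ 0 := by exact_mod_cast hN
    field_simp
  rw [this, Real.cos_nat_mul_pi]

/-- If `|G|` exceeds `1` by a margin `δ` at an extremum of `cos (N t)` and `G` moves by less than `δ`
up to the next one, then `G(t) cos (N t) + 1` changes sign in between. -/
theorem exists_zero_between_extrema {G : ℝ → ℝ} (hG : Continuous G) {N : ℕ} (hN : N ≠ 0) {k : ℕ}
    {δ : ℝ} (h1 : 1 + δ < |G (k * Real.pi / N)|)
    (h2 : |G ((k + 1 : ℕ) * Real.pi / N) - G (k * Real.pi / N)| < δ) :
    ∃ t ∈ Set.Ioo (k * Real.pi / N) ((k + 1 : ℕ) * Real.pi / N),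
      G t * Real.cos (N * t) + 1 = 0 := by
  have hN' : (0 : ℝ) < N := by positivity
  have hδ : 0 < δ := (abs_nonneg _).trans_lt h2
  have hab : k * Real.pi / N ≤ (k + 1 : ℕ) * Real.pi / N := by
    gcongr; omega
  have hcont : ContinuousOn (fun t => G t * Real.cos (N * t) + 1)
      (Set.Icc (k * Real.pi / N) ((k + 1 : ℕ) * Real.pi / N)) := by fun_prop
  have c1 := cos_nat_mul_pi_div hN k
  have c2 := cos_nat_mul_pi_div hN (k + 1)
  rw [abs_lt] at h2
  rw [lt_abs] at h1
  -- `cos (N t)` is `±1` at the two ends, with opposite signs, while `G` keeps its sign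
  have key : (G (k * Real.pi / N) * (-1) ^ k + 1 < 0 ∧
      0 < G ((k + 1 : ℕ) * Real.pi / N) * (-1) ^ (k + 1) + 1) ∨
      (0 < G (k * Real.pi / N) * (-1) ^ k + 1 ∧
      G ((k + 1 : ℕ) * Real.pi / N) * (-1) ^ (k + 1) + 1 < 0) := by
    rw [pow_succ]
    rcases neg_one_pow_eq_or ℝ k with hk | hk <;> rw [hk] <;> rcases h1 with h1 | h1
    · right; constructor <;> linarith
    · left; constructor <;> linarith
    · left; constructor <;> linarith
    · right; constructor <;> linarith
  rw [← c1, ← c2] at key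
  rcases key with ⟨k1, k2⟩ | ⟨k1, k2⟩
  · exact intermediate_value_Ioo hab hcont ⟨k1, k2⟩
  · exact intermediate_value_Ioo' hab hcont ⟨k2, k1⟩

/-- Asymptotically, every sample point `kπ/N`, `N = n + 2`, at which `|S(x)/x²|` exceeds `1` by a
fixed margin contributes a unimodular zero. -/
theorem eventually_sum_le_unimodularCount (A B : ℤ) {φ : AddCircle (2 * Real.pi) → ℝ}
    (h1 : ∀ θ, φ θ ≤ 1) {δ : ℝ} (hδ : 0 < δ)
    (h0 : ∀ θ, 0 < φ θ → 1 + δ < |quarticCosine A B θ|) :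
    ∀ᶠ n : ℕ in atTop, ∑ k ∈ Finset.range (2 * (n + 2)),
        φ ((k * Real.pi / (n + 2 : ℕ) : ℝ) : AddCircle (2 * Real.pi)) ≤
      unimodularCount (quarticTwist A B n) := by
  classical
  have huc := CompactSpace.uniformContinuous_of_continuous (continuous_quarticCosine A B)
  obtain ⟨η, hη, huc⟩ := Metric.uniformContinuous_iff.1 huc δ hδ
  have hlim : Tendsto (fun n : ℕ => Real.pi / ((n + 2 : ℕ) : ℝ)) atTop (𝓝 0) :=
    tendsto_const_nhds.div_atTop
      (tendsto_natCast_atTop_atTop.comp (tendsto_add_atTop_nat 2))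
  filter_upwards [hlim.eventually (gt_mem_nhds hη)] with n hn
  set N := n + 2 with hNdef
  have hN : N ≠ 0 := by omega
  have hN' : (0 : ℝ) < N := by positivity
  set K := (Finset.range (2 * N)).filter fun k : ℕ =>
    1 + δ < |quarticCosine A B ((k * Real.pi / N : ℝ) : AddCircle (2 * Real.pi))| with hK
  have hex : ∀ k ∈ K, ∃ t ∈ Set.Ioo (k * Real.pi / N) ((k + 1 : ℕ) * Real.pi / N),
      quarticCosine A B ((t : ℝ) : AddCircle (2 * Real.pi)) * Real.cos (N * t) + 1 = 0 := by
    intro k hk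
    refine exists_zero_between_extrema (δ := δ)
      (G := fun t : ℝ => quarticCosine A B (t : AddCircle (2 * Real.pi)))
      ((continuous_quarticCosine A B).comp (AddCircle.continuous_mk' _)) hN
      (Finset.mem_filter.1 hk).2 ?_
    have hd := huc (a := (((k + 1 : ℕ) * Real.pi / N : ℝ) : AddCircle (2 * Real.pi)))
      (b := ((k * Real.pi / N : ℝ) : AddCircle (2 * Real.pi))) ?_
    · rwa [Real.dist_eq] at hd
    · rw [dist_eq_norm, ← AddCircle.coe_sub]
      refine lt_of_le_of_lt (QuotientAddGroup.norm_mk_le_norm) ?_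
      have : ((k + 1 : ℕ) * Real.pi / N - k * Real.pi / N : ℝ) = Real.pi / N := by
        push_cast; ring
      rw [this, Real.norm_of_nonneg (by positivity)]
      exact hn
  choose! t ht hzero using hex
  have hinj : Set.InjOn (fun k => (toCircle (t k : AddCircle (2 * Real.pi)) : ℂ)) K := by
    have hmem : ∀ k ∈ K, t k ∈ Set.Ico (0 : ℝ) (0 + 2 * Real.pi) := by
      intro k hk
      have hk2 : k + 1 ≤ 2 * N := Finset.mem_range.1 (Finset.mem_filter.1 hk).1
      refine ⟨le_trans (by positivity) (ht k hk).1.le, (ht k hk).2.trans_le ?_⟩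
      rw [zero_add, div_le_iff₀ hN']
      have : ((k + 1 : ℕ) : ℝ) ≤ (2 * N : ℕ) := by exact_mod_cast hk2
      push_cast at this ⊢
      nlinarith [Real.pi_pos]
    have hlt : ∀ j ∈ K, ∀ k ∈ K, j < k → t j < t k := by
      intro j hj k hk hjk
      refine (ht j hj).2.trans_le (le_trans ?_ (ht k hk).1.le)
      gcongr
      exact hjk
    intro j hj k hk hjk
    have h2 := injective_toCircle Real.two_pi_pos.ne' (Circle.coe_injective hjk)
    have h3 := (AddCircle.coe_eq_coe_iff_of_mem_Ico (hmem j hj) (hmem k hk)).1 h2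
    rcases lt_trichotomy j k with h | h | h
    · exact absurd h3 (hlt j hj k hk h).ne
    · exact h
    · exact absurd h3 (hlt k hk j hj h).ne'
  have hcard : K.card ≤ unimodularCount (quarticTwist A B n) := by
    rw [← Finset.card_image_of_injOn hinj]
    refine card_le_unimodularCount (quarticTwist_monic A B n).ne_zero fun z hz => ?_
    obtain ⟨k, hk, rfl⟩ := Finset.mem_image.1 hz
    exact ⟨Circle.norm_coe _, (aeval_quarticTwist_coe_eq_zero_iff A B n _).2 (hzero k hk)⟩
  calc _ ≤ ∑ k ∈ Finset.range (2 * N), if k ∈ K then (1 : ℝ) else 0 := by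
        refine Finset.sum_le_sum fun k hk => ?_
        split_ifs with hkK
        · exact h1 _
        · by_contra! hlt
          exact hkK (Finset.mem_filter.2 ⟨hk, h0 _ hlt⟩)
    _ = K.card := by
        rw [Finset.sum_ite_mem, Finset.inter_eq_right.2 (Finset.filter_subset _ _),
          Finset.sum_const, nsmul_one]
    _ ≤ _ := by exact_mod_cast hcard

/-! ### Equidistribution of the sample points -/

/-- The points `kπ/N`, `0 ≤ k < 2N`, `N = n + 2`, are equidistributed: for `1 ≤ l < 2N` their
character sums vanish. -/
theorem tendsto_average_grid {φ : AddCircle (2 * Real.pi) → ℝ} (hφ : Continuous φ) :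
    Tendsto (fun n : ℕ => (∑ k ∈ Finset.range (2 * (n + 2)),
        φ ((k * Real.pi / (n + 2 : ℕ) : ℝ) : AddCircle (2 * Real.pi))) / (2 * (n + 2) : ℕ))
      atTop (𝓝 (∫ θ, φ θ ∂haarAddCircle)) := by
  have := tendsto_real_average_of_fourier (s := fun n : ℕ => (Multiset.range (2 * (n + 2))).map
    fun k : ℕ => ((k * Real.pi / (n + 2 : ℕ) : ℝ) : AddCircle (2 * Real.pi))) ?_ ?_ hφ
  · simp only [Multiset.map_map, Multiset.card_map, Multiset.card_range] at this
    exact this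
  · refine .of_forall fun n h => ?_
    have := congrArg Multiset.card h
    simp at this
  · intro l hl
    refine tendsto_const_nhds.congr' ?_
    filter_upwards [eventually_ge_atTop l] with n hn
    symm
    rw [Multiset.map_map]
    have hN : ((n + 2 : ℕ) : ℂ) ≠ 0 := by exact_mod_cast (by omega : n + 2 ≠ 0)
    have hpi : (Real.pi : ℂ) ≠ 0 := by exact_mod_cast Real.pi_ne_zero
    have hprim := Complex.isPrimitiveRoot_exp (2 * (n + 2)) (by omega)
    set ω := Complex.exp (2 * Real.pi * Complex.I / (2 * (n + 2) : ℕ)) with hω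
    have he : ((Multiset.range (2 * (n + 2))).map (fourier (l : ℤ) ∘ fun k : ℕ =>
        ((k * Real.pi / (n + 2 : ℕ) : ℝ) : AddCircle (2 * Real.pi)))).sum =
        ∑ k ∈ Finset.range (2 * (n + 2)), (ω ^ l) ^ k := by
      refine congrArg Multiset.sum (Multiset.map_congr rfl fun k _ => ?_)
      rw [Function.comp_apply, fourier_coe_apply, hω, ← Complex.exp_nat_mul, ← Complex.exp_nat_mul]
      congr 1
      push_cast
      push_cast at hN
      field_simp
    have h1 : ω ^ l ≠ 1 := hprim.pow_ne_one_of_pos_of_lt (by omega) (by omega)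
    rw [he, geom_sum_eq h1, ← pow_mul, mul_comm l, pow_mul, hprim.pow_eq_one, one_pow, sub_self,
      zero_div, zero_div]

/-! ### The limit ratio of a twisted quartic -/

/-- Continuous functions with values in `[0, 1]`, supported where `h > 1/j`, whose integrals
approximate the measure of `{h > 0}`. -/
theorem tendsto_integral_ramp {h : AddCircle (2 * Real.pi) → ℝ} (hh : Continuous h) :
    Tendsto (fun j : ℕ => ∫ θ, min 1 (max 0 (j * h θ - 1)) ∂haarAddCircle) atTop
      (𝓝 (haarAddCircle.real {θ | 0 < h θ})) := by
  have hmeas : MeasurableSet {θ | 0 < h θ} := (isOpen_lt continuous_const hh).measurableSet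
  rw [← integral_indicator_one hmeas]
  refine tendsto_integral_of_dominated_convergence (fun _ => 1) ?_ (integrable_const _) ?_ ?_
  · intro j
    have : Continuous fun θ => min 1 (max 0 (j * h θ - 1)) := by fun_prop
    exact this.aestronglyMeasurable
  · intro j
    refine .of_forall fun θ => ?_
    rw [Real.norm_eq_abs, abs_of_nonneg (le_min zero_le_one (le_max_left _ _))]
    exact min_le_left _ _
  · refine .of_forall fun θ => ?_
    rcases le_or_gt (h θ) 0 with hle | hlt
    · refine tendsto_const_nhds.congr fun j => ?_
      have h1 : (j : ℝ) * h θ - 1 ≤ 0 := by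
        nlinarith [mul_nonneg (Nat.cast_nonneg (α := ℝ) j) (neg_nonneg.2 hle)]
      rw [max_eq_left h1, min_eq_right zero_le_one, Set.indicator_of_notMem]
      exact hle.not_gt
    · refine tendsto_const_nhds.congr' ?_
      filter_upwards [(tendsto_natCast_atTop_atTop (R := ℝ)).eventually_ge_atTop (2 / h θ)]
        with j hj
      rw [div_le_iff₀ hlt] at hj
      rw [max_eq_right (by linarith), min_eq_left (by linarith), Set.indicator_of_mem]
      · rfl
      · exact hlt

/-- If `S(x)/x² = c` then `x` is a zero of the nonzero polynomial `S(x) - c x²`. -/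
theorem finite_norm_quarticCosine_eq_one (A B : ℤ) :
    {θ | |quarticCosine A B θ| = 1}.Finite := by
  set Q : ℂ → ℂ[X] := fun c => X ^ 4 + (C (A : ℂ) * X ^ 3 +
    C (B - c) * X ^ 2 + C (A : ℂ) * X + 1) with hQ
  have hQ0 : ∀ c, Q c ≠ 0 := by
    intro c
    refine (monic_X_pow_add (lt_of_le_of_lt (b := ((3 : ℕ) : WithBot ℕ)) ?_
      (by norm_num))).ne_zero
    refine degree_le_of_natDegree_le ?_
    compute_degree
  have hroot : ∀ (c : ℝ) θ, quarticCosine A B θ = c → (toCircle θ : ℂ) ∈ (Q c).rootSet ℂ := by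
    intro c θ hθ
    rw [mem_rootSet]
    refine ⟨hQ0 _, ?_⟩
    have := quartic_eq_sq_mul_quarticCosine A B θ
    rw [hθ] at this
    simp only [hQ, map_add, map_mul, map_pow, aeval_X, aeval_C, map_one, Algebra.algebraMap_self,
      RingHom.id_apply]
    push_cast at this
    linear_combination this
  have hinj : Function.Injective fun θ : AddCircle (2 * Real.pi) => (toCircle θ : ℂ) :=
    Circle.coe_injective.comp (injective_toCircle Real.two_pi_pos.ne')
  refine (((rootSet_finite (Q (1 : ℝ)) ℂ).union (rootSet_finite (Q (-1 : ℝ)) ℂ)).preimage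
    hinj.injOn).subset fun θ hθ => ?_
  rcases eq_or_eq_neg_of_abs_eq hθ with h | h
  · exact Or.inl (hroot 1 θ h)
  · exact Or.inr (by simpa using hroot (-1) θ h)

theorem haarAddCircle_finite_eq_zero {s : Set (AddCircle (2 * Real.pi))} (hs : s.Finite) :
    (haarAddCircle : Measure (AddCircle (2 * Real.pi))) s = 0 := by
  have hne : (𝓝[≠] (0 : AddCircle (2 * Real.pi))).NeBot := by
    have ht : Tendsto (fun t : ℝ => (t : AddCircle (2 * Real.pi))) (𝓝[>] 0) (𝓝[≠] 0) := by
      rw [tendsto_nhdsWithin_iff]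
      refine ⟨((AddCircle.continuous_mk' _).tendsto 0).mono_left nhdsWithin_le_nhds, ?_⟩
      filter_upwards [Ioo_mem_nhdsGT Real.two_pi_pos] with t ht h0
      have h1 := (AddCircle.coe_eq_coe_iff_of_mem_Ico (p := 2 * Real.pi) (a := 0)
        (x := t) (y := 0) ⟨ht.1.le, by linarith [ht.2]⟩
        ⟨le_rfl, by linarith [Real.two_pi_pos]⟩).1 h0
      exact ht.1.ne' h1
    exact ht.neBot
  exact hs.measure_zero _

/-- Both inequalities for the limit come from lower bounds for counts: of nonunimodular zeros by
equidistribution of arguments, of unimodular zeros by sign changes. They are complementary because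
`|S(x)/x²| = 1` only at finitely many points of the circle. -/
theorem isLimitRatio_quarticTwist (A B : ℤ) :
    IsLimitRatio (fun n => quarticTwist A B n)
      (haarAddCircle.real {θ | |quarticCosine A B θ| < 1}) := by
  set g := quarticCosine A B with hg
  have hgc : Continuous g := continuous_quarticCosine A B
  have hcompl : haarAddCircle.real {θ | |g θ| < 1} =
      1 - haarAddCircle.real {θ | 0 < |g θ| - 1} := by
    have hm : MeasurableSet {θ | 0 < |g θ| - 1} :=
      (isOpen_lt continuous_const (by fun_prop)).measurableSet
    rw [← probReal_compl_eq_one_sub hm]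
    refine measureReal_congr ?_
    have h0 := haarAddCircle_finite_eq_zero (finite_norm_quarticCosine_eq_one A B)
    have hae : ∀ᵐ θ ∂haarAddCircle, |g θ| ≠ 1 := by
      rw [ae_iff]; simpa using h0
    filter_upwards [hae] with θ hθ
    refine propext ?_
    change |g θ| < 1 ↔ ¬ (0 < |g θ| - 1)
    rw [not_lt, sub_nonpos]
    exact ⟨le_of_lt, fun h => lt_of_le_of_ne h hθ⟩
  have hratio : ∀ n, nonunimodularRatio (quarticTwist A B n) =
      1 - (unimodularCount (quarticTwist A B n) : ℝ) / (2 * n + 8 : ℕ) := by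
    intro n
    have h := counts_add_eq_natDegree (quarticTwist_monic A B n)
    rw [quarticTwist_natDegree] at h
    rw [nonunimodularRatio, quarticTwist_natDegree, eq_sub_iff_add_eq, ← add_div, div_eq_one_iff_eq
      (by positivity)]
    exact_mod_cast (by omega)
  rw [IsLimitRatio, tendsto_order]
  constructor
  · intro a ha
    have hsub : {θ | |g θ| < 1} = {θ | 0 < 1 - |g θ|} := by ext θ; simp
    rw [hsub] at ha
    obtain ⟨j, hj⟩ := ((tendsto_integral_ramp (h := fun θ => 1 - |g θ|) (by fun_prop)).eventually
      (lt_mem_nhds ha)).exists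
    set ψ : AddCircle (2 * Real.pi) → ℝ := fun θ => min 1 (max 0 (j * (1 - |g θ|) - 1)) with hψ
    obtain ⟨L, hL⟩ := exists_sum_norm_coeff_quarticTwist_le A B
    have hlim := tendsto_average_arg_roots (φ := ψ)
      (p := fun n => (quarticTwist A B n).map (algebraMap ℤ ℂ))
      (fun n => (quarticTwist_monic A B n).map _)
      (fun n => by rw [coeff_map, quarticTwist_coeff_zero]; simp) hL
      (by
        simp_rw [(quarticTwist_monic A B _).natDegree_map, quarticTwist_natDegree]
        exact tendsto_atTop_mono (fun n => show n ≤ 2 * n + 8 by omega) tendsto_id) (by fun_prop)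
    filter_upwards [hlim.eventually (lt_mem_nhds hj)] with n hn
    refine hn.trans_le ?_
    rw [nonunimodularRatio, (quarticTwist_monic A B n).natDegree_map]
    gcongr
    refine sum_map_arg_le_nonunimodular A B n (fun θ => min_le_left _ _) fun θ hθ => ?_
    rw [hψ, lt_min_iff, lt_max_iff] at hθ
    have h1 : 0 < (j : ℝ) * (1 - |g θ|) - 1 := hθ.2.resolve_left (lt_irrefl _)
    by_contra! hge
    nlinarith [mul_nonneg (Nat.cast_nonneg (α := ℝ) j) (sub_nonneg.2 hge)]
  · intro b hb
    rw [hcompl] at hb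
    obtain ⟨j, hj⟩ := ((tendsto_integral_ramp (h := fun θ => |g θ| - 1) (by fun_prop)).eventually
      (lt_mem_nhds (by linarith : 1 - b < haarAddCircle.real {θ | 0 < |g θ| - 1}))).exists
    set φ : AddCircle (2 * Real.pi) → ℝ := fun θ => min 1 (max 0 (j * (|g θ| - 1) - 1)) with hφ
    -- `φ` is supported where `|g| - 1 > 1/j`; the margin `1/(j+1)` also makes sense for `j = 0`
    have hev := eventually_sum_le_unimodularCount A B (φ := φ) (fun θ => min_le_left _ _)
      (δ := 1 / (j + 1)) (by positivity) (fun θ hθ => by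
        rw [hφ, lt_min_iff, lt_max_iff] at hθ
        have h1 : 0 < (j : ℝ) * (|g θ| - 1) - 1 := hθ.2.resolve_left (lt_irrefl _)
        have hj0 : (0 : ℝ) ≤ j := Nat.cast_nonneg j
        have h2 : 0 < |g θ| - 1 := by
          by_contra! hle
          nlinarith
        have h3 : 1 / ((j : ℝ) + 1) < |g θ| - 1 := by
          rw [div_lt_iff₀ (by positivity)]
          nlinarith
        linarith)
    have hgrid := tendsto_average_grid (φ := φ) (by fun_prop)
    have hdeg : Tendsto (fun n : ℕ => ((2 * (n + 2) : ℕ) : ℝ) / (2 * n + 8 : ℕ)) atTop (𝓝 1) := by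
      have h1 : Tendsto (fun n : ℕ => 1 - 4 / ((2 * n + 8 : ℕ) : ℝ)) atTop (𝓝 (1 - 0)) :=
        tendsto_const_nhds.sub (tendsto_const_nhds.div_atTop
          (tendsto_natCast_atTop_atTop.comp
            (tendsto_atTop_mono (fun n => show n ≤ 2 * n + 8 by omega) tendsto_id)))
      rw [sub_zero] at h1
      refine h1.congr fun n => ?_
      have : ((2 * n + 8 : ℕ) : ℝ) ≠ 0 := by positivity
      rw [eq_div_iff this, sub_mul, div_mul_cancel₀ _ this]
      push_cast; ring
    have hprod := hgrid.mul hdeg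
    rw [mul_one] at hprod
    filter_upwards [hprod.eventually (lt_mem_nhds hj), hev] with n hn hle
    rw [div_mul_div_cancel₀ (by positivity)] at hn
    rw [hratio]
    have : 1 - b < (unimodularCount (quarticTwist A B n) : ℝ) / (2 * n + 8 : ℕ) :=
      hn.trans_le (by gcongr)
    linarith

/-! ### The conjugates of powers of the Salem number -/

/-- The quartic `x⁴ - x³ - x² - x + 1`. -/
noncomputable def salemQuartic : ℤ[X] := X ^ 4 - X ^ 3 - X ^ 2 - X + 1

theorem salemQuartic_natDegree : salemQuartic.natDegree = 4 := by
  unfold salemQuartic; compute_degree!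

theorem salemQuartic_monic : salemQuartic.Monic := by
  unfold salemQuartic; monicity!

theorem salemQuartic_coeff (k : ℕ) : salemQuartic.coeff k =
    if k = 0 then 1 else if k = 1 then -1 else if k = 2 then -1 else if k = 3 then -1
    else if k = 4 then 1 else 0 := by
  unfold salemQuartic
  simp only [coeff_add, coeff_sub, coeff_X_pow, coeff_X, coeff_one, eq_comm (a := 1)]
  split_ifs <;> first | rfl | omega

theorem Polynomial.Monic.eq_linear {f : ℤ[X]} (hf : f.Monic) (h : f.natDegree = 1) :
    f = X + C (f.coeff 0) := by
  ext k
  have h1 := hf.coeff_natDegree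
  rw [h] at h1
  rcases k with _ | _ | k
  · simp
  · rw [coeff_add, coeff_X_one, coeff_C_of_ne_zero (by omega), add_zero, h1]
  · rw [coeff_eq_zero_of_natDegree_lt (by omega), coeff_add, coeff_X_of_ne_one (by omega),
      coeff_C_of_ne_zero (by omega), add_zero]

theorem salemQuartic_irreducible : Irreducible salemQuartic := by
  have hne : salemQuartic ≠ 1 := by
    intro h
    have := salemQuartic_natDegree
    rw [h] at this
    simp at this
  refine salemQuartic_monic.irreducible_iff_natDegree'.2 ⟨hne, ?_⟩
  intro f g hf hg hfg hd
  rw [salemQuartic_natDegree] at hd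
  have hdeg : f.natDegree + g.natDegree = 4 := by
    rw [← hf.natDegree_mul hg, hfg, salemQuartic_natDegree]
  have hg' : g.natDegree = 1 ∨ g.natDegree = 2 := by
    simp only [Finset.mem_Ioc] at hd; omega
  rcases hg' with h1 | h2
  · -- a linear factor gives an integer root dividing the constant coefficient
    have hgl := hg.eq_linear h1
    have h0 := congrArg (eval (-g.coeff 0)) hfg
    rw [eval_mul, hgl] at h0
    simp only [salemQuartic, eval_add, eval_X, eval_C, eval_sub, eval_pow, eval_one, coeff_add,
      coeff_X_zero, coeff_C_zero, zero_add, neg_add_cancel, mul_zero] at h0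
    generalize g.coeff 0 = r at h0
    have hr : r ∣ 1 := ⟨-(r ^ 3 + r ^ 2 - r + 1), by linarith⟩
    rcases Int.isUnit_iff.mp (isUnit_of_dvd_one hr) with rfl | rfl <;> norm_num at h0
  · have h2' : f.natDegree = 2 := by omega
    have cf := hf.coeff_natDegree
    have cg := hg.coeff_natDegree
    rw [h2'] at cf
    rw [h2] at cg
    have e0 := congrArg (fun p => coeff p 0) hfg
    have e1 := congrArg (fun p => coeff p 1) hfg
    have e2 := congrArg (fun p => coeff p 2) hfg
    have e3 := congrArg (fun p => coeff p 3) hfg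
    have f3 : f.coeff 3 = 0 := coeff_eq_zero_of_natDegree_lt (by omega)
    have g3 : g.coeff 3 = 0 := coeff_eq_zero_of_natDegree_lt (by omega)
    simp only [coeff_mul, salemQuartic_coeff, Finset.Nat.sum_antidiagonal_eq_sum_range_succ_mk,
      Finset.sum_range_succ, Finset.sum_range_zero] at e0 e1 e2 e3
    norm_num [cf, cg, f3, g3] at e0 e1 e2 e3
    generalize f.coeff 0 = b at *
    generalize g.coeff 0 = d at *
    generalize f.coeff 1 = a at *
    generalize g.coeff 1 = c at *
    have hb : b ∣ 1 := ⟨d, e0.symm⟩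
    rcases Int.isUnit_iff.mp (isUnit_of_dvd_one hb) with rfl | rfl
    · obtain rfl : d = 1 := by linarith
      -- `a + c = -1` and `a c = -3` would make the discriminant `13` a square
      have hc : c = -1 - a := by linarith
      subst hc
      have h13 : a * (a + 1) = 3 := by linarith
      have : a ≤ 2 := by nlinarith
      have : -3 ≤ a := by nlinarith
      interval_cases a <;> omega
    · obtain rfl : d = -1 := by linarith
      omega

theorem aeval_salemQuartic {A : Type*} [CommRing A] (x : A) :
    aeval x salemQuartic = x ^ 4 - x ^ 3 - x ^ 2 - x + 1 := by
  simp [salemQuartic]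

theorem isIntegral_of_quartic {A : Type*} [CommRing A] {x : A}
    (hx : x ^ 4 - x ^ 3 - x ^ 2 - x + 1 = 0) : IsIntegral ℤ x :=
  ⟨salemQuartic, salemQuartic_monic, by
    rw [← aeval_def, aeval_salemQuartic, hx]⟩

theorem minpoly_eq_salemQuartic {A : Type*} [CommRing A] [IsDomain A] [CharZero A] {x : A}
    (hx : x ^ 4 - x ^ 3 - x ^ 2 - x + 1 = 0) : minpoly ℤ x = salemQuartic := by
  have h0 : aeval x salemQuartic = 0 := by rw [aeval_salemQuartic, hx]
  have hint := isIntegral_of_quartic hx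
  refine eq_of_monic_of_associated (minpoly.monic hint) salemQuartic_monic ?_
  exact ((minpoly.irreducible hint).associated_of_dvd salemQuartic_irreducible
    (minpoly.isIntegrallyClosed_dvd hint h0))

/-- Integer polynomial relations satisfied by one root of the quartic hold for all of them. -/
theorem aeval_conjugate_eq_zero {A B : Type*} [CommRing A] [IsDomain A] [CharZero A] [CommRing B]
    {x : A} {y : B} (hx : x ^ 4 - x ^ 3 - x ^ 2 - x + 1 = 0)
    (hy : y ^ 4 - y ^ 3 - y ^ 2 - y + 1 = 0) {q : ℤ[X]} (hq : aeval x q = 0) :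
    aeval y q = 0 := by
  obtain ⟨r, rfl⟩ := minpoly.isIntegrallyClosed_dvd (isIntegral_of_quartic hx) hq
  rw [minpoly_eq_salemQuartic hx, map_mul, aeval_salemQuartic, hy, zero_mul]

/-- With `y = x + 1/x` the quartic becomes `y² - y - 3`, whose root other than `γ + 1/γ` lies in
`(-2, 2)` and so comes from a point of the unit circle. -/
theorem exists_unimodular_conjugate {γ : ℝ} (hγ : 1 < γ)
    (hroot : γ ^ 4 - γ ^ 3 - γ ^ 2 - γ + 1 = 0) :
    ∃ a : ℂ, ‖a‖ = 1 ∧ a ^ 4 - a ^ 3 - a ^ 2 - a + 1 = 0 := by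
  have hγ0 : γ ≠ 0 := by positivity
  set w : ℝ := γ + 1 / γ with hw
  have hw2 : w ^ 2 - w - 3 = 0 := by
    rw [hw]; field_simp; linear_combination hroot
  have hw_gt : 2 < w := by
    have : w - 2 = (γ - 1) ^ 2 / γ := by rw [hw]; field_simp; ring
    have h2 : 0 < (γ - 1) ^ 2 / γ := by
      have : 0 < γ - 1 := by linarith
      positivity
    linarith
  have hw_lt : w < 3 := by nlinarith
  set y : ℝ := 1 - w with hy
  have hs : 0 ≤ 1 - y ^ 2 / 4 := by nlinarith
  refine ⟨⟨y / 2, √(1 - y ^ 2 / 4)⟩, ?_, ?_⟩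
  · rw [← sq_eq_sq₀ (norm_nonneg _) zero_le_one, ← Complex.normSq_eq_norm_sq, Complex.normSq_mk]
    have := Real.mul_self_sqrt hs
    linarith
  · set a : ℂ := ⟨y / 2, √(1 - y ^ 2 / 4)⟩ with ha
    have key : a ^ 2 = y * a - 1 := by
      have := Real.mul_self_sqrt hs
      rw [pow_two y] at this
      apply Complex.ext <;> simp [ha, pow_two] <;> linarith
    have hyc : (y : ℂ) ^ 2 - y - 3 = 0 := by
      have : y ^ 2 - y - 3 = 0 := by rw [hy]; linear_combination hw2
      exact_mod_cast this
    linear_combination (a ^ 2 + (y - 1) * a + (y ^ 2 - y - 2)) * key + (y * a - 1) * hyc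

theorem ne_zero_of_quartic {x : ℂ} (h : x ^ 4 - x ^ 3 - x ^ 2 - x + 1 = 0) : x ≠ 0 := by
  rintro rfl; norm_num at h

theorem quartic_inv {x : ℂ} (h : x ^ 4 - x ^ 3 - x ^ 2 - x + 1 = 0) :
    x⁻¹ ^ 4 - x⁻¹ ^ 3 - x⁻¹ ^ 2 - x⁻¹ + 1 = 0 := by
  have := ne_zero_of_quartic h
  field_simp
  linear_combination h

/-- The number `γ ^ m` lies in the quartic field `ℚ(γ)`. -/
theorem natDegree_salemPoly_le {γ : ℝ} (hroot : γ ^ 4 - γ ^ 3 - γ ^ 2 - γ + 1 = 0) (m : ℕ) :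
    (salemPoly γ m).natDegree ≤ 4 := by
  have hint := isIntegral_of_quartic hroot
  have hq : IsIntegral ℚ γ := hint.tower_top
  have hdeg : Module.finrank ℚ (IntermediateField.adjoin ℚ {γ}) = 4 := by
    rw [IntermediateField.adjoin.finrank hq, minpoly.isIntegrallyClosed_eq_field_fractions' ℚ hint,
      (minpoly.monic hint).natDegree_map, minpoly_eq_salemQuartic hroot, salemQuartic_natDegree]
  have : FiniteDimensional ℚ (IntermediateField.adjoin ℚ {γ}) :=
    IntermediateField.adjoin.finiteDimensional hq
  let x : IntermediateField.adjoin ℚ {γ} :=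
    ⟨γ ^ m, pow_mem (IntermediateField.mem_adjoin_simple_self ℚ γ) m⟩
  have h1 := minpoly.natDegree_le (A := ℚ) x
  have h2 : minpoly ℚ x = minpoly ℚ (γ ^ m) :=
    (minpoly.algebraMap_eq (algebraMap (IntermediateField.adjoin ℚ {γ}) ℝ).injective x).symm
  rw [hdeg, h2, minpoly.isIntegrallyClosed_eq_field_fractions' ℚ (hint.pow m),
    (minpoly.monic (hint.pow m)).natDegree_map] at h1
  exact h1

open ComplexConjugate in
/-- The conjugates of `γ ^ m` are the `m`-th powers of those of `γ`. They are distinct: a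
coincidence `a ^ (2m) = 1` for the unimodular conjugate would carry over to `γ`. -/
theorem aroots_salemPoly {γ : ℝ} (hγ : 1 < γ) (hroot : γ ^ 4 - γ ^ 3 - γ ^ 2 - γ + 1 = 0)
    {a : ℂ} (ha : ‖a‖ = 1) (haroot : a ^ 4 - a ^ 3 - a ^ 2 - a + 1 = 0) {m : ℕ} (hm : 1 ≤ m) :
    (salemPoly γ m).aroots ℂ = {(γ : ℂ) ^ m, (γ : ℂ)⁻¹ ^ m, a ^ m, a⁻¹ ^ m} := by
  have hint := (isIntegral_of_quartic hroot).pow m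
  have hmon : (salemPoly γ m).Monic := minpoly.monic hint
  have hγm : 1 < γ ^ m := one_lt_pow₀ hγ (by omega)
  have ha0 : a ≠ 0 := ne_zero_of_quartic haroot
  have hγC : (γ : ℂ) ^ 4 - (γ : ℂ) ^ 3 - (γ : ℂ) ^ 2 - γ + 1 = 0 := by exact_mod_cast hroot
  have hconj : ∀ ξ : ℂ, ξ ^ 4 - ξ ^ 3 - ξ ^ 2 - ξ + 1 = 0 → ξ ^ m ∈ (salemPoly γ m).aroots ℂ := by
    intro ξ hξ
    rw [mem_aroots]
    refine ⟨hmon.ne_zero, ?_⟩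
    -- `S_m(x ^ m)` vanishes at `γ`, hence at its conjugate `ξ`
    have h := aeval_conjugate_eq_zero hroot hξ (q := expand ℤ m (salemPoly γ m))
      (by rw [expand_aeval]; exact minpoly.aeval ℤ (γ ^ m))
    rwa [expand_aeval] at h
  have n1 : ‖(γ : ℂ) ^ m‖ = γ ^ m := by
    rw [norm_pow, Complex.norm_real, Real.norm_of_nonneg (by linarith)]
  have n2 : ‖(γ : ℂ)⁻¹ ^ m‖ = (γ ^ m)⁻¹ := by rw [inv_pow, norm_inv, n1]
  have n3 : ‖a ^ m‖ = 1 := by rw [norm_pow, ha, one_pow]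
  have n4 : ‖a⁻¹ ^ m‖ = 1 := by rw [inv_pow, norm_inv, n3, inv_one]
  have hlt : (γ ^ m)⁻¹ < 1 := inv_lt_one_of_one_lt₀ hγm
  have d34 : a ^ m ≠ a⁻¹ ^ m := by
    intro h
    have h1 : a ^ (2 * m) = 1 := by
      rw [two_mul, pow_add]
      nth_rw 2 [h]
      rw [← mul_pow, mul_inv_cancel₀ ha0, one_pow]
    have h2 := aeval_conjugate_eq_zero haroot hroot (q := X ^ (2 * m) - 1) (by simp [h1])
    simp only [map_sub, map_pow, aeval_X, map_one] at h2
    have := one_lt_pow₀ hγ (by omega : 2 * m ≠ 0)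
    linarith
  have hnodup : ({(γ : ℂ) ^ m, (γ : ℂ)⁻¹ ^ m, a ^ m, a⁻¹ ^ m} : Multiset ℂ).Nodup := by
    simp only [Multiset.insert_eq_cons, Multiset.nodup_cons, Multiset.mem_cons,
      Multiset.mem_singleton, Multiset.nodup_singleton, and_true, not_or]
    refine ⟨⟨?_, ?_, ?_⟩, ⟨?_, ?_⟩, d34⟩ <;> intro h <;> have h := congrArg norm h <;>
      simp only [n1, n2, n3, n4] at h <;> linarith
  symm
  apply Multiset.eq_of_le_of_card_le
  · rw [Multiset.le_iff_subset hnodup]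
    intro z hz
    simp only [Multiset.insert_eq_cons, Multiset.mem_cons, Multiset.mem_singleton] at hz
    rcases hz with rfl | rfl | rfl | rfl
    · exact hconj _ hγC
    · exact hconj _ (quartic_inv hγC)
    · exact hconj _ haroot
    · exact hconj _ (quartic_inv haroot)
  · refine (card_roots' _).trans ?_
    rw [hmon.natDegree_map]
    simpa using natDegree_salemPoly_le hroot m

/-! ### Short arcs -/

theorem haarAddCircle_arc_eq {b : ℂ} (hb : ‖b‖ = 1) (r : ℝ) :
    haarAddCircle.real {θ : AddCircle (2 * Real.pi) | ‖(toCircle θ : ℂ) - b‖ < r} =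
      haarAddCircle.real {θ : AddCircle (2 * Real.pi) | ‖(toCircle θ : ℂ) - 1‖ < r} := by
  set θ₀ : AddCircle (2 * Real.pi) := (Complex.arg b : AddCircle (2 * Real.pi)) with hθ₀
  have h0 : (toCircle θ₀ : ℂ) = b := toCircle_arg hb
  have hb0 : b ≠ 0 := norm_ne_zero_iff.1 (by rw [hb]; exact one_ne_zero)
  have hset : {θ : AddCircle (2 * Real.pi) | ‖(toCircle θ : ℂ) - b‖ < r} =
      (fun θ => -θ₀ + θ) ⁻¹' {θ | ‖(toCircle θ : ℂ) - 1‖ < r} := by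
    ext θ
    simp only [Set.mem_preimage, Set.mem_ofPred_eq, toCircle_add, toCircle_neg, Circle.coe_mul,
      Circle.coe_inv, h0]
    have : b⁻¹ * (toCircle θ : ℂ) - 1 = b⁻¹ * ((toCircle θ : ℂ) - b) := by field_simp
    rw [this, norm_mul, norm_inv, hb, inv_one, one_mul]
  rw [hset, measureReal_def, measure_preimage_add, measureReal_def]

theorem exists_arc_measure_lt {ε : ℝ} (hε : 0 < ε) : ∃ r : ℝ, 0 < r ∧
    haarAddCircle.real {θ : AddCircle (2 * Real.pi) | ‖(toCircle θ : ℂ) - 1‖ < r} < ε := by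
  set s : ℕ → Set (AddCircle (2 * Real.pi)) :=
    fun n => {θ | ‖(toCircle θ : ℂ) - 1‖ < 1 / ((n : ℝ) + 1)} with hs
  have hopen : ∀ n, IsOpen (s n) := fun n => isOpen_lt (by fun_prop) continuous_const
  have hanti : Antitone s := by
    intro m n hmn θ hθ
    have h : ‖(toCircle θ : ℂ) - 1‖ < 1 / ((n : ℝ) + 1) := hθ
    exact h.trans_le (Nat.one_div_le_one_div hmn)
  have hinter : ⋂ n, s n = {0} := by
    ext θ
    simp only [Set.mem_iInter, Set.mem_singleton_iff]
    constructor
    · intro h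
      have h1 : ‖(toCircle θ : ℂ) - 1‖ ≤ 0 := by
        by_contra! hlt
        obtain ⟨n, hn⟩ := exists_nat_one_div_lt hlt
        exact lt_asymm hn (h n)
      have h2 : (toCircle θ : ℂ) = 1 := sub_eq_zero.1 (norm_le_zero_iff.1 h1)
      refine injective_toCircle Real.two_pi_pos.ne' (Circle.coe_injective ?_)
      rw [h2, toCircle_zero, Circle.coe_one]
    · rintro rfl n
      simp only [hs, Set.mem_ofPred_eq, toCircle_zero, Circle.coe_one, sub_self, norm_zero]
      positivity
  have hlim := tendsto_measure_iInter_atTop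
    (μ := (haarAddCircle : Measure (AddCircle (2 * Real.pi))))
    (fun n => (hopen n).measurableSet.nullMeasurableSet) hanti ⟨0, measure_ne_top _ _⟩
  rw [hinter, haarAddCircle_finite_eq_zero (Set.finite_singleton _)] at hlim
  have hlim' := (ENNReal.tendsto_toReal ENNReal.zero_ne_top).comp hlim
  obtain ⟨n, hn⟩ := (hlim'.eventually (gt_mem_nhds (by simpa using hε))).exists
  exact ⟨1 / ((n : ℝ) + 1), by positivity, hn⟩

/-- On the unit circle `|2 Re x - 2 Re b| = |x - b| |x - b̄|`, so smallness of the left side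
confines `x` to two short arcs. -/
theorem haarAddCircle_re_sub_lt_le {b : ℂ} (hb : ‖b‖ = 1) {r : ℝ} (hr : 0 < r) :
    haarAddCircle.real
      {θ : AddCircle (2 * Real.pi) | |2 * (toCircle θ : ℂ).re - 2 * b.re| < r ^ 2} ≤
      2 * haarAddCircle.real {θ : AddCircle (2 * Real.pi) | ‖(toCircle θ : ℂ) - 1‖ < r} := by
  have hsub : {θ : AddCircle (2 * Real.pi) | |2 * (toCircle θ : ℂ).re - 2 * b.re| < r ^ 2} ⊆
      {θ | ‖(toCircle θ : ℂ) - b‖ < r} ∪ {θ | ‖(toCircle θ : ℂ) - (starRingEnd ℂ) b‖ < r} := by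
    intro θ hθ
    by_contra hnot
    simp only [Set.mem_union, Set.mem_ofPred_eq, not_or, not_lt] at hnot hθ
    set x : ℂ := (toCircle θ : ℂ) with hx
    have hx1 : ‖x‖ = 1 := Circle.norm_coe _
    have h1 := sq_add_one_of_norm_eq_one hx1
    have h2 : b + (starRingEnd ℂ) b = (2 * b.re : ℝ) := Complex.add_conj b
    have h3 : b * (starRingEnd ℂ) b = 1 := by
      rw [Complex.mul_conj, Complex.normSq_eq_norm_sq, hb]; norm_num
    have key : (x - b) * (x - (starRingEnd ℂ) b) = x * ((2 * x.re - 2 * b.re : ℝ) : ℂ) := by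
      push_cast at h2 ⊢
      linear_combination h1 - x * h2 + h3
    have hn := congrArg norm key
    rw [norm_mul, norm_mul, hx1, one_mul, Complex.norm_real, Real.norm_eq_abs] at hn
    nlinarith [hnot.1, hnot.2]
  refine (measureReal_mono hsub).trans ((measureReal_union_le _ _).trans ?_)
  have hb' : ‖(starRingEnd ℂ) b‖ = 1 := by rw [Complex.norm_conj, hb]
  have e1 := haarAddCircle_arc_eq hb r
  have e2 := haarAddCircle_arc_eq hb' r
  linarith

/-! ### The Salem family -/

theorem quarticCosine_eq_mul {A B u v : ℝ} (hA : A = -(u + v)) (hB : B = 2 + u * v)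
    (θ : AddCircle (2 * Real.pi)) : quarticCosine A B θ =
      (2 * (toCircle θ : ℂ).re - u) * (2 * (toCircle θ : ℂ).re - v) := by
  have h : ‖(toCircle θ : ℂ)‖ = 1 := Circle.norm_coe _
  have h1 : (toCircle θ : ℂ).re * (toCircle θ : ℂ).re +
      (toCircle θ : ℂ).im * (toCircle θ : ℂ).im = 1 := by
    rw [← Complex.normSq_apply, Complex.normSq_eq_norm_sq, h, one_pow]
  unfold quarticCosine
  rw [hA, hB, pow_two, Complex.mul_re]
  linear_combination -2 * h1

section Salem

variable {γ : ℝ} (hγ : 1 < γ) (hroot : γ ^ 4 - γ ^ 3 - γ ^ 2 - γ + 1 = 0) {a : ℂ} (ha : ‖a‖ = 1)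
  (haroot : a ^ 4 - a ^ 3 - a ^ 2 - a + 1 = 0) {m : ℕ} (hm : 1 ≤ m)

include hγ hroot ha haroot hm

theorem salemPoly_natDegree : (salemPoly γ m).natDegree = 4 := by
  have hmon : (salemPoly γ m).Monic := minpoly.monic ((isIntegral_of_quartic hroot).pow m)
  have := splits_iff_card_roots.1 (IsAlgClosed.splits ((salemPoly γ m).map (algebraMap ℤ ℂ)))
  rw [hmon.natDegree_map] at this
  rw [← this, ← aroots, aroots_salemPoly hγ hroot ha haroot hm]
  rfl

theorem isSalemNumber_pow : IsSalemNumber (γ ^ m) := by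
  have hγm : 1 < γ ^ m := one_lt_pow₀ hγ (by omega)
  have n1 : ‖(γ : ℂ) ^ m‖ = γ ^ m := by
    rw [norm_pow, Complex.norm_real, Real.norm_of_nonneg (by linarith)]
  have n2 : ‖(γ : ℂ)⁻¹ ^ m‖ = (γ ^ m)⁻¹ := by rw [inv_pow, norm_inv, n1]
  have n3 : ‖a ^ m‖ = 1 := by rw [norm_pow, ha, one_pow]
  have n4 : ‖a⁻¹ ^ m‖ = 1 := by rw [inv_pow, norm_inv, n3, inv_one]
  have hlt : (γ ^ m)⁻¹ < 1 := inv_lt_one_of_one_lt₀ hγm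
  refine ⟨(isIntegral_of_quartic hroot).pow m, hγm, ?_, ?_⟩
  · rw [← salemPoly, salemPoly_natDegree hγ hroot ha haroot hm, unimodularCount,
      aroots_salemPoly hγ hroot ha haroot hm]
    simp only [Multiset.insert_eq_cons, ← Multiset.cons_zero, Multiset.countP_cons,
      Multiset.countP_zero, n1, n2, n3, n4, hlt.ne, hγm.ne', if_true, if_false]
  · rw [← salemPoly, insideCount, aroots_salemPoly hγ hroot ha haroot hm]
    simp only [Multiset.insert_eq_cons, ← Multiset.cons_zero, Multiset.countP_cons,
      Multiset.countP_zero, n1, n2, n3, n4, hlt, hγm.not_gt, lt_irrefl, if_true, if_false]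

/-- The coefficients of the product `(x² - u x + 1)(x² - v x + 1)`, with
`u = γ ^ m + γ ^ (-m)` and `v = a ^ m + a ^ (-m) = 2 Re a ^ m`. -/
theorem salemPoly_coeff : (salemPoly γ m).coeff 0 = 1 ∧ (salemPoly γ m).coeff 4 = 1 ∧
    (salemPoly γ m).coeff 3 = (salemPoly γ m).coeff 1 ∧
    (((salemPoly γ m).coeff 1 : ℤ) : ℝ) = -((γ ^ m + (γ ^ m)⁻¹) + 2 * (a ^ m).re) ∧
    (((salemPoly γ m).coeff 2 : ℤ) : ℝ) = 2 + (γ ^ m + (γ ^ m)⁻¹) * (2 * (a ^ m).re) := by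
  have hmon : (salemPoly γ m).Monic := minpoly.monic ((isIntegral_of_quartic hroot).pow m)
  set S := (salemPoly γ m).map (algebraMap ℤ ℂ) with hS
  have hprod := (IsAlgClosed.splits S).eq_prod_roots_of_monic (hmon.map _)
  have hroots : S.roots = {(γ : ℂ) ^ m, (γ : ℂ)⁻¹ ^ m, a ^ m, a⁻¹ ^ m} :=
    aroots_salemPoly hγ hroot ha haroot hm
  have hγ0 : (γ : ℂ) ^ m ≠ 0 := pow_ne_zero _ (by exact_mod_cast (by linarith : γ ≠ 0))
  have hn : ‖a ^ m‖ = 1 := by rw [norm_pow, ha, one_pow]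
  have ha0 : a ^ m ≠ 0 := norm_ne_zero_iff.1 (by rw [hn]; exact one_ne_zero)
  have hv : a ^ m + (a ^ m)⁻¹ = (2 * (a ^ m).re : ℝ) := by
    rw [← Complex.add_conj, Complex.inv_def, Complex.normSq_eq_norm_sq, hn]; simp
  set u : ℝ := γ ^ m + (γ ^ m)⁻¹ with hu
  set v : ℝ := 2 * (a ^ m).re with hv'
  have hSe : S = X ^ 4 + C (-(u + v) : ℂ) * X ^ 3 + C (2 + u * v : ℂ) * X ^ 2 +
      C (-(u + v) : ℂ) * X + C 1 := by
    have h1 : (X - C ((γ : ℂ) ^ m)) * (X - C ((γ : ℂ)⁻¹ ^ m)) =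
        X ^ 2 - C (u : ℂ) * X + 1 := by
      have e : C ((γ : ℂ) ^ m) * C ((γ : ℂ)⁻¹ ^ m) = 1 := by
        rw [← map_mul, inv_pow, mul_inv_cancel₀ hγ0, map_one]
      have e2 : C (u : ℂ) = C ((γ : ℂ) ^ m) + C ((γ : ℂ)⁻¹ ^ m) := by
        rw [← map_add, hu, inv_pow]; push_cast; rfl
      rw [e2]; linear_combination e
    have h2 : (X - C (a ^ m)) * (X - C (a⁻¹ ^ m)) =
        X ^ 2 - C (v : ℂ) * X + 1 := by
      have e : C (a ^ m) * C (a⁻¹ ^ m) = 1 := by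
        rw [← map_mul, inv_pow, mul_inv_cancel₀ ha0, map_one]
      have e2 : C (v : ℂ) = C (a ^ m) + C (a⁻¹ ^ m) := by
        rw [← map_add, ← hv, inv_pow]
      rw [e2]; linear_combination e
    rw [hprod, hroots]
    simp only [Multiset.insert_eq_cons, Multiset.map_cons, Multiset.map_singleton,
      Multiset.prod_cons, Multiset.prod_singleton]
    rw [h2, ← mul_assoc, h1]
    simp only [map_neg, map_add, map_mul, map_one, map_ofNat]
    ring
  have hc : ∀ k, (((salemPoly γ m).coeff k : ℤ) : ℂ) = S.coeff k := fun k => by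
    rw [hS, coeff_map]; rfl
  have c0 := hc 0
  have c1 := hc 1
  have c2 := hc 2
  have c3 := hc 3
  have c4 := hc 4
  rw [hSe] at c0 c1 c2 c3 c4
  simp only [coeff_add, coeff_C_mul, coeff_X_pow, coeff_X, coeff_C] at c0 c1 c2 c3 c4
  norm_num at c0 c1 c2 c3 c4
  refine ⟨by exact_mod_cast c0, by exact_mod_cast c4, ?_, ?_, ?_⟩
  · have := c3.trans c1.symm
    exact_mod_cast this
  · have : (((salemPoly γ m).coeff 1 : ℤ) : ℂ) = ((-(u + v) : ℝ) : ℂ) := by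
      rw [c1]; push_cast; ring
    exact_mod_cast this
  · have : (((salemPoly γ m).coeff 2 : ℤ) : ℂ) = ((2 + u * v : ℝ) : ℂ) := by
      rw [c2]; push_cast; ring
    exact_mod_cast this

theorem polyT_eq_quarticTwist (n : ℕ) : polyT γ n m =
    quarticTwist ((salemPoly γ m).coeff 1) ((salemPoly γ m).coeff 2) n := by
  obtain ⟨h0, h4, h3, -, -⟩ := salemPoly_coeff hγ hroot ha haroot hm
  simp only [polyT, salemCoeff, Finset.sum_range_succ, Finset.sum_range_zero, Nat.sub_zero,
    Nat.sub_self, Nat.reduceSub, h0, h4, h3, quarticTwist, map_one]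
  ring

theorem quarticCosine_salemPoly (θ : AddCircle (2 * Real.pi)) :
    quarticCosine ((salemPoly γ m).coeff 1) ((salemPoly γ m).coeff 2) θ =
      (2 * (toCircle θ : ℂ).re - (γ ^ m + (γ ^ m)⁻¹)) *
        (2 * (toCircle θ : ℂ).re - 2 * (a ^ m).re) := by
  obtain ⟨-, -, -, h1, h2⟩ := salemPoly_coeff hγ hroot ha haroot hm
  exact quarticCosine_eq_mul h1 h2 θ

/-- The limit ratio is positive: `S_m(x)/x²` vanishes at the conjugate `a ^ m` of `γ ^ m`, hence is
small on an arc around it. -/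
theorem limitRatio_pos : 0 < haarAddCircle.real
    {θ | |quarticCosine ((salemPoly γ m).coeff 1) ((salemPoly γ m).coeff 2) θ| < 1} := by
  have hopen : IsOpen
      {θ | |quarticCosine ((salemPoly γ m).coeff 1) ((salemPoly γ m).coeff 2) θ| < 1} :=
    isOpen_lt (continuous_quarticCosine _ _).abs continuous_const
  have hn : ‖a ^ m‖ = 1 := by rw [norm_pow, ha, one_pow]
  refine ENNReal.toReal_pos (hopen.measure_pos _ ⟨(Complex.arg (a ^ m) : _), ?_⟩).ne'
    (measure_ne_top _ _)
  rw [Set.mem_ofPred_eq, quarticCosine_salemPoly hγ hroot ha haroot hm, toCircle_arg hn]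
  simp

/-- The factor of `S_m(x)/x²` belonging to `γ ^ m` is at least `γ ^ m - 2` in modulus, so the other
factor must be small where the product is. -/
theorem limitRatio_le {r : ℝ} (hr : 0 < r) (hlarge : 2 + 1 / r ^ 2 ≤ γ ^ m) :
    haarAddCircle.real
      {θ | |quarticCosine ((salemPoly γ m).coeff 1) ((salemPoly γ m).coeff 2) θ| < 1} ≤
      2 * haarAddCircle.real {θ : AddCircle (2 * Real.pi) | ‖(toCircle θ : ℂ) - 1‖ < r} := by
  have hn : ‖a ^ m‖ = 1 := by rw [norm_pow, ha, one_pow]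
  refine le_trans (measureReal_mono fun θ hθ => ?_) (haarAddCircle_re_sub_lt_le hn hr)
  rw [Set.mem_ofPred_eq, quarticCosine_salemPoly hγ hroot ha haroot hm, abs_mul] at hθ
  rw [Set.mem_ofPred_eq]
  have hre : (toCircle θ : ℂ).re ≤ 1 := (Complex.re_le_norm _).trans (Circle.norm_coe _).le
  have hinv : 0 < (γ ^ m)⁻¹ := inv_pos.2 (by positivity)
  have h1 : 1 / r ^ 2 ≤ |2 * (toCircle θ : ℂ).re - (γ ^ m + (γ ^ m)⁻¹)| := by
    rw [abs_sub_comm]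
    exact le_trans (by linarith) (le_abs_self _)
  have h2 : 1 / r ^ 2 * |2 * (toCircle θ : ℂ).re - 2 * (a ^ m).re| < 1 :=
    (mul_le_mul_of_nonneg_right h1 (abs_nonneg _)).trans_lt hθ
  rwa [one_div, inv_mul_lt_iff₀ (by positivity), mul_one] at h2

theorem le_abs_salemPoly_coeff_one : γ ^ m - 2 ≤ |(((salemPoly γ m).coeff 1 : ℤ) : ℝ)| := by
  obtain ⟨-, -, -, h1, -⟩ := salemPoly_coeff hγ hroot ha haroot hm
  have hn : ‖a ^ m‖ = 1 := by rw [norm_pow, ha, one_pow]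
  have hre := (abs_le.1 ((Complex.abs_re_le_norm _).trans hn.le)).1
  have hinv : 0 < (γ ^ m)⁻¹ := inv_pos.2 (by positivity)
  rw [h1, abs_neg]
  exact le_trans (by linarith) (le_abs_self _)

end Salem

theorem mainTheorem2 (γ : ℝ) (hγ : 1 < γ) (hroot : γ ^ 4 - γ ^ 3 - γ ^ 2 - γ + 1 = 0) :
    (∀ m : ℕ, 1 ≤ m → IsSalemNumber (γ ^ m) ∧ (salemPoly γ m).natDegree = 4) ∧
    (∃ LC : ℕ → ℝ,
      (∀ m : ℕ, 1 ≤ m → IsLimitRatio (fun n => polyT γ n m) (LC m)) ∧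
      Tendsto LC atTop (𝓝 0) ∧
      (∀ ε : ℝ, 0 < ε → ∃ m : ℕ, 1 ≤ m ∧ 0 < LC m ∧ LC m < ε)) ∧
    (∀ N : ℤ, ∃ m : ℕ, 1 ≤ m ∧ ∀ n : ℕ, 1 ≤ n → ∃ i : ℕ, N < |(polyT γ n m).coeff i|) := by
  obtain ⟨a, ha, haroot⟩ := exists_unimodular_conjugate hγ hroot
  have hpow := tendsto_pow_atTop_atTop_of_one_lt hγ
  refine ⟨fun m hm => ⟨isSalemNumber_pow hγ hroot ha haroot hm,
    salemPoly_natDegree hγ hroot ha haroot hm⟩, ?_, fun N => ?_⟩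
  · set LC : ℕ → ℝ := fun m => haarAddCircle.real
      {θ | |quarticCosine ((salemPoly γ m).coeff 1) ((salemPoly γ m).coeff 2) θ| < 1} with hLC
    have hlim : Tendsto LC atTop (𝓝 0) := by
      rw [tendsto_order]
      refine ⟨fun b hb => .of_forall fun m => hb.trans_le measureReal_nonneg, fun ε hε => ?_⟩
      obtain ⟨r, hr, hlt⟩ := exists_arc_measure_lt (half_pos hε)
      filter_upwards [hpow.eventually_ge_atTop (2 + 1 / r ^ 2), eventually_ge_atTop 1] with m h1 hm
      have := limitRatio_le hγ hroot ha haroot hm hr h1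
      exact this.trans_lt (by linarith)
    refine ⟨LC, fun m hm => ?_, hlim, fun ε hε => ?_⟩
    · simp_rw [polyT_eq_quarticTwist hγ hroot ha haroot hm]
      exact isLimitRatio_quarticTwist _ _
    · obtain ⟨m, hlt, hm⟩ := ((hlim.eventually (gt_mem_nhds hε)).and (eventually_ge_atTop 1)).exists
      exact ⟨m, hm, limitRatio_pos hγ hroot ha haroot hm, hlt⟩
  · obtain ⟨m, hlt, hm⟩ := ((hpow.eventually_gt_atTop ((N : ℝ) + 2)).and
      (eventually_ge_atTop 1)).exists
    refine ⟨m, hm, fun n _ => ⟨1, ?_⟩⟩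
    rw [polyT_eq_quarticTwist hγ hroot ha haroot hm, quarticTwist_coeff_one]
    have h := le_abs_salemPoly_coeff_one hγ hroot ha haroot hm
    have : (N : ℝ) < |(((salemPoly γ m).coeff 1 : ℤ) : ℝ)| := by linarith
    exact_mod_cast this
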